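/- **Proposition 1 (Uplink/Downlink μWave).** Let $\alpha_\mu>2$, $\lambda_\mu,\lambda_u>0$. In the plane, let the μWave base stations (BSs) form a homogeneous Poisson point process of intensity $\lambda_\mu$ and let the users form an independent homogeneous Poisson point process of intensity $\lambda_u$, to which a typical user $U_0$ at the origin is added. Every user associates with its nearest BS; let $X_0$ be the BS of $U_0$ and $r=|X_0|$. A BS is active if it serves at least one user. All links have unit transmit power, path loss $d\mapsto d^{-\alpha_\mu}$, and independent fading gains that are exponential with mean $1$ and independent of all locations; the noise power is $\sigma^2\ge 0$. In the downlink, $\mathsf{SINR}=g\,r^{-\alpha_\mu}/\big(\sum_i g_i r_i^{-\alpha_\mu}+\sigma^2\big)$, the sum running over all active BSs other than $X_0$, at distances $r_i$ from the origin. In the uplink, $\mathsf{SINR}=h\,r^{-\alpha_\mu}/\big(\sum_j h_j d_j^{-\alpha_\mu}+\sigma^2\big)$, the sum running over the users transmitting simultaneously with $U_0$, at distances $d_j$ from $X_0$; these users are any (random) set of users not associated with $X_0$ that contains at least one user of each active BS other than $X_0$ (for instance exactly one user per active BS, chosen by any scheduling rule). The spectral efficiency is $\gamma_\mu=\mathsf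 E\log(1+\mathsf{SINR})\in[0,\infty]$ (natural logarithm). Then, in the interference-limited regime, i.e. for all $\sigma^2\in[0,\sigma_0^2]$ with some $\sigma_0^2>0$ depending only on $\alpha_\mu,\lambda_\mu,\lambda_u$, both the downlink spectral efficiency and the uplink spectral efficiency (for every such set of simultaneously transmitting users) satisfy $$\gamma_\mu>\log\Big(1+\Big[\frac{\lambda_\mu}{\rho_\mu\lambda_u}\Big]^{\alpha_\mu/2}\Big),\qquad \rho_\mu=\int_0^\infty\frac{du}{1+u^{\alpha_\mu/2}}.$$ This holds for all $\lambda_\mu,\lambda_u>0$, in particular in the ultra-dense regime $\lambda_\mu\gg\lambda_u$. Moreover, for fixed $\lambda_u$ the lower bound grows logarithmically in the BS density: it is asymptotically equivalent to $\frac{\alpha_\mu}{2}\log\lambda_\mu$ as $\lambda_\mu\to\infty$. -/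

import Mathlib

open MeasureTheory ProbabilityTheory Filter Topology Asymptotics
open scoped ENNReal NNReal

noncomputable section

namespace UltraDense

/-- The Euclidean plane in which base stations and users live. -/
abbrev Plane : Type := EuclideanSpace ℝ (Fin 2)

/-- The number of points of the configuration `x 0, x 1, x 2, …` lying in `B`. -/
def pointCount (x : ℕ → Plane) (B : Set Plane) : ℕ∞ := {n | x n ∈ B}.encard

/-- The random points `X 0, X 1, …` enumerate a homogeneous Poisson point process of intensity
`lam` in the plane: the number of points in a bounded Borel set `B` is Poisson distributed with
mean `lam * area B`, and the numbers of points in disjoint bounded Borel sets are independent. -/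
structure IsHomogeneousPPP {Ω : Type*} [MeasurableSpace Ω] (P : Measure Ω)
    (X : ℕ → Ω → Plane) (lam : ℝ) : Prop where
  measurable : ∀ n, Measurable (X n)
  count_law : ∀ B : Set Plane, MeasurableSet B → Bornology.IsBounded B →
    HasLaw (fun ω => pointCount (fun n => X n ω) B)
      ((poissonMeasure (ENNReal.ofReal lam * volume B).toNNReal).map (fun k : ℕ => (k : ℕ∞))) P
  count_indep : ∀ (m : ℕ) (B : Fin m → Set Plane), (∀ k, MeasurableSet (B k)) →
    (∀ k, Bornology.IsBounded (B k)) → Pairwise (fun k l => Disjoint (B k) (B l)) →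
    iIndepFun (fun (k : Fin m) ω => pointCount (fun n => X n ω) (B k)) P

/-- Rayleigh fading: the power gains `g i` are independent and exponentially distributed with
mean `1`, and the whole family is independent of the locations `X` of the base stations and `U`
of the users. -/
structure IsRayleighFading {Ω ι : Type*} [MeasurableSpace Ω] (P : Measure Ω)
    (g : ι → Ω → ℝ) (X U : ℕ → Ω → Plane) : Prop where
  measurable : ∀ i, Measurable (g i)
  law : ∀ i, HasLaw (g i) (expMeasure 1) P
  indep : iIndepFun g P
  indep_locations :
    IndepFun (fun ω i => g i ω) (fun ω => ((fun n => X n ω), (fun n => U n ω))) P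

/-- `x i` is a base station nearest to the location `p`. -/
def IsNearest (x : ℕ → Plane) (p : Plane) (i : ℕ) : Prop := ∀ j, dist p (x i) ≤ dist p (x j)

open Classical in
/-- The index of the base station with which a receiver at `p` associates: the nearest one.
(For a Poisson process it almost surely exists and is unique; the value `0` is only used when
there is no nearest base station.) -/
def assoc (x : ℕ → Plane) (p : Plane) : ℕ :=
  if h : ∃ i, IsNearest x p i then Nat.find h else 0

/-- The base station `x i` is active, i.e. serves one of the users `u 0, u 1, …`. The typical
user at the origin is not in this list; the base station serving it is `assoc x 0`. -/
def IsActive (x u : ℕ → Plane) (i : ℕ) : Prop := ∃ j, assoc x (u j) = i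

/-- Power received over distance `d` with fading gain `g`, path-loss exponent `α` and unit
transmit power. -/
def rxPower (α g d : ℝ) : ℝ≥0∞ := ENNReal.ofReal (g * d ^ (-α))

open Classical in
/-- Downlink SINR of the typical user at the origin: the signal comes from the nearest base
station, the interference from all other active base stations. The gain `g i` belongs to the link
from base station `i` to the typical user, and `noise` is the noise power. -/
def downlinkSINR (α noise : ℝ) (x u : ℕ → Plane) (g : ℕ → ℝ) : ℝ≥0∞ :=
  rxPower α (g (assoc x 0)) ‖x (assoc x 0)‖ /
    ((∑' i, if i ≠ assoc x 0 ∧ IsActive x u i then rxPower α (g i) ‖x i‖ else 0)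
      + ENNReal.ofReal noise)

open Classical in
/-- Uplink SINR of the typical user at the origin, measured at its base station `x (assoc x 0)`:
the interference comes from the set `S` of (indices of) the other users transmitting at the same
time. The gain `h none` belongs to the typical user and `h (some j)` to user `j`. -/
def uplinkSINR (α noise : ℝ) (x u : ℕ → Plane) (h : Option ℕ → ℝ) (S : Set ℕ) : ℝ≥0∞ :=
  rxPower α (h none) ‖x (assoc x 0)‖ /
    ((∑' j, if j ∈ S then rxPower α (h (some j)) (dist (u j) (x (assoc x 0))) else 0)
      + ENNReal.ofReal noise)

/-- `S ω` is a possible set of users transmitting in the uplink simultaneously with the typical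
user: none of them is in the cell of the typical user, and every active base station other than
that of the typical user receives from at least one of its own users. (This covers
one user per cell at a time, chosen by any rule, as well as all users transmitting.) -/
structure IsUplinkSchedule {Ω : Type*} [MeasurableSpace Ω] (P : Measure Ω)
    (X U : ℕ → Ω → Plane) (S : Ω → Set ℕ) : Prop where
  measurable : ∀ j, MeasurableSet {ω | j ∈ S ω}
  other_cell : ∀ᵐ ω ∂P, ∀ j ∈ S ω,
    assoc (fun n => X n ω) (U j ω) ≠ assoc (fun n => X n ω) 0
  busy : ∀ᵐ ω ∂P, ∀ i, i ≠ assoc (fun n => X n ω) 0 →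
    IsActive (fun n => X n ω) (fun n => U n ω) i →
    ∃ j ∈ S ω, assoc (fun n => X n ω) (U j ω) = i

/-- Ergodic spectral efficiency `E log (1 + SINR)` in nats/s/Hz, the expectation of a nonnegative
random variable. -/
def spectralEfficiency {Ω : Type*} [MeasurableSpace Ω] (P : Measure Ω) (sinr : Ω → ℝ≥0∞) : ℝ≥0∞ :=
  ∫⁻ ω, (ENNReal.log (1 + sinr ω)).toENNReal ∂P

/-- The constant `ρ = ∫₀^∞ du / (1 + u ^ (α / 2))`. -/
def rho (α : ℝ) : ℝ := ∫ u in Set.Ioi (0 : ℝ), 1 / (1 + u ^ (α / 2))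

/-- The lower bound `log (1 + (lamB / (ρ lamU)) ^ (α / 2))`. -/
def seBound (α lamB lamU : ℝ) : ℝ := Real.log (1 + (lamB / (rho α * lamU)) ^ (α / 2))

end UltraDense

end

/-! Both links obey the same coverage bound. Without noise, P(SINR > t) is at least λ_B / (λ_B + λ_U
ρ t^(2/α)) = 1 / (1 + (t/m)^(2/α)), where m = (λ_B / (ρ λ_U))^(α/2). Since E log(1 + SINR) = ∫
P(SINR > t) dt/(1+t), it remains to see that this log-logistic tail integrates to more than log(1 +
m); the inversion t ↦ m²/t shows it (`log_one_add_lt_lintegral`).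

For the coverage bound, fix the distance r to the serving station. With exponential fading the
success probability given all locations is a noise factor times a product of 1/(1 + c_i) over
interferers (`measure_signal_gt`). Charging interferers to users bounds this below by a product over
the points of the user process. The Poisson Laplace functional averages the users to exp(-λ_U A),
where A is a mean load over the plane depending on the stations only, and Jensen's inequality
replaces A by its conditional mean (`mul_expNeg_le_measure_coverage`).

In the downlink a location y interferes through its own station. Given the serving station, and if y
is served by another one, the position of that other station is dominated, on discs around the
origin, by the nearest-point law of an unconditioned process
(`IsHomogeneousPPP.measure_norm_assoc_lt`). The density of that law is symmetric in y and the
station, so integrating over y gives Lebesgue measure, and the mean of A is at most ρ t^(2/α) π r²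
(`IsHomogeneousPPP.setLIntegral_otherCell_le`). In the uplink all users may be taken to transmit,
and translation invariance gives the same bound. As π r² is exponential with rate λ_B, averaging
over r yields the claim.

Conditioning on r is replaced by shells: the nearest station lies in an annulus of area δ, alone
there. Finitely many shells of small mesh already beat the target strictly, which leaves room for a
positive noise level (`exists_seBound_lt`). -/

noncomputable section

namespace UltraDense

/-! ### The exponential `e ^ (-a)` and the logarithm `log (1 + c)` on `[0, ∞]` -/

/-- `e ^ (-a)` for `a ∈ [0, ∞]`. -/
def expNeg (a : ℝ≥0∞) : ℝ≥0∞ := (EReal.exp (a : EReal))⁻¹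

/-- `log (1 + c)` for `c ∈ [0, ∞]`. -/
def logOnePlus (c : ℝ≥0∞) : ℝ≥0∞ := (ENNReal.log (1 + c)).toENNReal

lemma expNeg_add (a b : ℝ≥0∞) : expNeg (a + b) = expNeg a * expNeg b := by
  unfold expNeg
  rw [EReal.coe_ennreal_add, EReal.exp_add, ENNReal.mul_inv] <;> simp

@[simp] lemma expNeg_zero : expNeg 0 = 1 := by simp [expNeg]

@[simp] lemma expNeg_top : expNeg ∞ = 0 := by simp [expNeg]

lemma expNeg_ofReal {r : ℝ} (hr : 0 ≤ r) :
    expNeg (ENNReal.ofReal r) = ENNReal.ofReal (Real.exp (-r)) := by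
  unfold expNeg
  rw [EReal.coe_ennreal_ofReal, max_eq_left hr, EReal.exp_coe,
    ← ENNReal.ofReal_inv_of_pos (Real.exp_pos _), Real.exp_neg]

lemma antitone_expNeg : Antitone expNeg := fun a b h => by
  unfold expNeg
  exact ENNReal.inv_le_inv.2 (EReal.exp_monotone (by exact_mod_cast h))

lemma expNeg_le_one (a : ℝ≥0∞) : expNeg a ≤ 1 := by
  simpa using antitone_expNeg (zero_le : 0 ≤ a)

lemma continuous_expNeg : Continuous expNeg := by
  unfold expNeg
  exact continuous_inv.comp (ENNReal.continuous_exp.comp continuous_coe_ennreal_ereal)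

lemma measurable_expNeg : Measurable expNeg := continuous_expNeg.measurable

@[fun_prop]
lemma _root_.Measurable.expNeg {E : Type*} [MeasurableSpace E] {f : E → ℝ≥0∞}
    (hf : Measurable f) : Measurable fun x => expNeg (f x) := measurable_expNeg.comp hf

lemma expNeg_sum {ι : Type*} (s : Finset ι) (f : ι → ℝ≥0∞) :
    expNeg (∑ i ∈ s, f i) = ∏ i ∈ s, expNeg (f i) := by
  classical
  induction s using Finset.induction_on with
  | empty => simp
  | insert a s ha ih => rw [Finset.sum_insert ha, Finset.prod_insert ha, expNeg_add, ih]

lemma measurable_logOnePlus : Measurable logOnePlus := by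
  unfold logOnePlus
  fun_prop

@[fun_prop]
lemma _root_.Measurable.logOnePlus {E : Type*} [MeasurableSpace E] {f : E → ℝ≥0∞}
    (hf : Measurable f) : Measurable fun x => logOnePlus (f x) := measurable_logOnePlus.comp hf

/-- Writes the exponential Laplace transform 1/(1 + c) as an exponential, so that products over
interferers become sums of `logOnePlus`. -/
lemma expNeg_logOnePlus (c : ℝ≥0∞) : expNeg (logOnePlus c) = (1 + c)⁻¹ := by
  unfold expNeg logOnePlus
  rw [EReal.coe_toENNReal, ENNReal.exp_log]
  simp

lemma logOnePlus_ofReal {r : ℝ} (hr : 0 ≤ r) :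
    logOnePlus (ENNReal.ofReal r) = ENNReal.ofReal (Real.log (1 + r)) := by
  unfold logOnePlus
  rw [← ENNReal.ofReal_one, ← ENNReal.ofReal_add zero_le_one hr,
    ENNReal.log_ofReal_of_pos (by positivity)]
  simp

@[simp] lemma logOnePlus_zero : logOnePlus 0 = 0 := by simp [logOnePlus]

@[simp] lemma logOnePlus_top : logOnePlus ∞ = ∞ := by simp [logOnePlus]

/-- Jensen's inequality for `e ^ (-f)` on a set `G`, by comparison with the tangent line. -/
lemma mul_expNeg_le_setLIntegral {Ω : Type*} [MeasurableSpace Ω] {P : Measure Ω}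
    {G : Set Ω} (hGfin : P G ≠ ∞) {f : Ω → ℝ≥0∞} (hf : Measurable f)
    {a : ℝ≥0∞} (h : ∫⁻ ω in G, f ω ∂P ≤ P G * a) :
    P G * expNeg a ≤ ∫⁻ ω in G, expNeg (f ω) ∂P := by
  rcases eq_or_ne a ∞ with rfl | ha
  · simp
  -- Tangent line of e^(-x) at `a`, arranged without subtraction so that it makes sense on [0, ∞].
  -- At `x = ∞` it holds because `expNeg a ≠ 0`.
  have key : ∀ x : ℝ≥0∞, expNeg a * (1 + a) ≤ expNeg x + expNeg a * x := by
    intro x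
    rcases eq_or_ne x ∞ with rfl | hx
    · have : expNeg a ≠ 0 := by
        rw [← ENNReal.ofReal_toReal ha, expNeg_ofReal ENNReal.toReal_nonneg]
        simp [Real.exp_pos]
      simp [ENNReal.mul_top this]
    · rw [← ENNReal.ofReal_toReal ha, ← ENNReal.ofReal_toReal hx,
        expNeg_ofReal ENNReal.toReal_nonneg, expNeg_ofReal ENNReal.toReal_nonneg,
        ← ENNReal.ofReal_one, ← ENNReal.ofReal_add zero_le_one ENNReal.toReal_nonneg,
        ← ENNReal.ofReal_mul (by positivity), ← ENNReal.ofReal_mul (by positivity),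
        ← ENNReal.ofReal_add (by positivity) (by positivity)]
      apply ENNReal.ofReal_le_ofReal
      set A := a.toReal
      set X := x.toReal
      have h1 : Real.exp (-X) = Real.exp (-A) * Real.exp (A - X) := by
        rw [← Real.exp_add]; ring_nf
      have h2 := Real.add_one_le_exp (A - X)
      have h3 := Real.exp_pos (-A)
      rw [h1]
      nlinarith
  have hE : expNeg a ≠ ∞ := ((expNeg_le_one a).trans_lt ENNReal.one_lt_top).ne
  have h1 : ∫⁻ ω in G, expNeg a * (1 + a) ∂P ≤ ∫⁻ ω in G, expNeg (f ω) ∂P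
      + expNeg a * ∫⁻ ω in G, f ω ∂P := by
    rw [← lintegral_const_mul _ hf, ← lintegral_add_left hf.expNeg]
    exact lintegral_mono fun ω => key _
  rw [setLIntegral_const] at h1
  have h2 : expNeg a * (1 + a) * P G ≤ ∫⁻ ω in G, expNeg (f ω) ∂P + expNeg a * (P G * a) :=
    h1.trans (by gcongr)
  have h3 : expNeg a * (1 + a) * P G = P G * expNeg a + expNeg a * (P G * a) := by ring
  rw [h3] at h2
  exact (ENNReal.add_le_add_iff_right
    (ENNReal.mul_ne_top hE (ENNReal.mul_ne_top hGfin ha))).1 h2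

lemma lintegral_Ioc_one_div_one_add {r : ℝ} (hr : 0 ≤ r) :
    ∫⁻ t in Set.Ioc 0 r, ENNReal.ofReal (1 / (1 + t)) = ENNReal.ofReal (Real.log (1 + r)) := by
  have hd : ∀ x ∈ Set.uIcc 0 r, HasDerivAt (fun t : ℝ => Real.log (1 + t)) (1 / (1 + x)) x := by
    intro x hx
    rw [Set.uIcc_of_le hr] at hx
    have : (1 : ℝ) + x ≠ 0 := by linarith [hx.1]
    simpa using ((hasDerivAt_id x).const_add 1).log this
  have hint : IntervalIntegrable (fun x : ℝ => 1 / (1 + x)) volume 0 r := by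
    apply ContinuousOn.intervalIntegrable
    apply ContinuousOn.div continuousOn_const (by fun_prop)
    intro x hx
    rw [Set.uIcc_of_le hr] at hx
    linarith [hx.1]
  have hftc := intervalIntegral.integral_eq_sub_of_hasDerivAt hd hint
  rw [intervalIntegral.integral_of_le hr] at hftc
  rw [← ofReal_integral_eq_lintegral_ofReal ((intervalIntegrable_iff_integrableOn_Ioc_of_le hr).1
    hint), hftc]
  · simp
  · filter_upwards [ae_restrict_mem measurableSet_Ioc] with x hx
    have : 0 < 1 + x := by linarith [hx.1]
    positivity

/-- Layer-cake lower bound for `log (1 + z)`. -/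
lemma lintegral_indicator_le_logOnePlus (z : ℝ≥0∞) :
    ∫⁻ t in Set.Ioi (0 : ℝ), {t : ℝ | ENNReal.ofReal t < z}.indicator
      (fun t => ENNReal.ofReal (1 / (1 + t))) t ≤ logOnePlus z := by
  rcases eq_or_ne z ∞ with rfl | hz
  · simp
  obtain ⟨r, hr, rfl⟩ : ∃ r : ℝ, 0 ≤ r ∧ z = ENNReal.ofReal r :=
    ⟨z.toReal, ENNReal.toReal_nonneg, (ENNReal.ofReal_toReal hz).symm⟩
  have h0 : ∀ t ∈ Set.Ioi (0 : ℝ), {t : ℝ | ENNReal.ofReal t < ENNReal.ofReal r}.indicator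
      (fun t => ENNReal.ofReal (1 / (1 + t))) t =
      (Set.Iio r).indicator (fun t => ENNReal.ofReal (1 / (1 + t))) t := by
    intro t ht
    have : (ENNReal.ofReal t < ENNReal.ofReal r) ↔ t < r := by
      rw [ENNReal.ofReal_lt_ofReal_iff_of_nonneg (le_of_lt ht)]
    simp [Set.indicator, this]
  rw [setLIntegral_congr_fun measurableSet_Ioi h0, lintegral_indicator measurableSet_Iio,
    Measure.restrict_restrict measurableSet_Iio, logOnePlus_ofReal hr]
  have hsub : Set.Iio r ∩ Set.Ioi 0 ⊆ Set.Ioc 0 r := fun x hx => ⟨hx.2, le_of_lt hx.1⟩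
  exact (lintegral_mono_set hsub).trans (lintegral_Ioc_one_div_one_add hr).le

/-! ### Rayleigh fading -/

/-- Integrating a function of two independent random variables over independent copies. -/
lemma lintegral_indepFun_eq {Ω E F : Type*} [MeasurableSpace Ω] [MeasurableSpace E]
    [MeasurableSpace F] {P : Measure Ω} [IsProbabilityMeasure P] {A : Ω → E} {B : Ω → F}
    (hA : Measurable A) (hB : Measurable B) (h : IndepFun A B P) {f : E × F → ℝ≥0∞}
    (hf : Measurable f) :
    ∫⁻ ω, f (A ω, B ω) ∂P = ∫⁻ ω, ∫⁻ ω', f (A ω, B ω') ∂P ∂P := by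
  rw [indepFun_iff_map_prod_eq_prod_map_map hA.aemeasurable hB.aemeasurable] at h
  have : IsProbabilityMeasure (P.map B) := Measure.isProbabilityMeasure_map hB.aemeasurable
  rw [← lintegral_map (g := fun ω => (A ω, B ω)) hf (hA.prodMk hB), h, lintegral_prod _ hf.aemeasurable,
    lintegral_map hf.lintegral_prod_right' hA]
  refine lintegral_congr fun ω => ?_
  exact lintegral_map (hf.comp measurable_prodMk_left) hB

lemma lintegral_expMeasure (f : ℝ → ℝ≥0∞) (hf : Measurable f) :
    ∫⁻ x, f x ∂(expMeasure 1) = ∫⁻ x in Set.Ioi 0, ENNReal.ofReal (Real.exp (-x)) * f x := by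
  have hm : Measurable (exponentialPDF 1) :=
    (measurable_exponentialPDFReal 1).ennreal_ofReal
  have hd : expMeasure 1 = volume.withDensity (exponentialPDF 1) := rfl
  rw [hd, lintegral_withDensity_eq_lintegral_mul _ hm hf,
    ← lintegral_indicator measurableSet_Ioi]
  refine lintegral_congr_ae ?_
  filter_upwards [Measure.ae_ne volume 0] with x hx
  rcases lt_or_gt_of_ne hx with h | h
  · simp [exponentialPDF_of_neg h, Set.indicator, h.le]
  · simp [exponentialPDF_of_nonneg h.le, Set.indicator, h]

lemma lintegral_Ioi_exp_neg_mul {b a : ℝ} (hb : 0 < b) :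
    ∫⁻ x in Set.Ioi a, ENNReal.ofReal (Real.exp (-(b * x)))
      = ENNReal.ofReal (Real.exp (-(b * a)) / b) := by
  have h := integral_exp_mul_Ioi (a := -b) (by linarith) a
  have hi := integrableOn_exp_mul_Ioi (a := -b) (by linarith) a
  simp only [neg_mul] at h hi
  rw [← ofReal_integral_eq_lintegral_ofReal hi (Eventually.of_forall fun x => (Real.exp_pos _).le), h]
  congr 1
  field_simp

/-- This is what makes Rayleigh fading tractable: the probability of beating a fixed interference
level is an exponential of that level. -/
lemma expMeasure_tail (a : ℝ≥0∞) :
    ∫⁻ x, {x : ℝ | a < ENNReal.ofReal x}.indicator 1 x ∂(expMeasure 1) = expNeg a := by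
  have hms : MeasurableSet {x : ℝ | a < ENNReal.ofReal x} :=
    measurableSet_lt measurable_const ENNReal.measurable_ofReal
  rcases eq_or_ne a ∞ with rfl | ha
  · simp
  rw [lintegral_expMeasure _ (measurable_one.indicator hms)]
  have h1 : ∀ x ∈ Set.Ioi (0 : ℝ), ENNReal.ofReal (Real.exp (-x)) *
      {x : ℝ | a < ENNReal.ofReal x}.indicator 1 x =
      (Set.Ioi a.toReal).indicator (fun x => ENNReal.ofReal (Real.exp (-(1 * x)))) x := by
    intro x hx
    have : a < ENNReal.ofReal x ↔ a.toReal < x := ENNReal.lt_ofReal_iff_toReal_lt ha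
    by_cases h : a.toReal < x <;> simp [Set.indicator, this, h]
  rw [setLIntegral_congr_fun measurableSet_Ioi h1, lintegral_indicator measurableSet_Ioi,
    Measure.restrict_restrict measurableSet_Ioi,
    Set.inter_eq_left.2 (Set.Ioi_subset_Ioi ENNReal.toReal_nonneg),
    lintegral_Ioi_exp_neg_mul one_pos]
  conv_rhs => rw [← ENNReal.ofReal_toReal ha, expNeg_ofReal ENNReal.toReal_nonneg]
  simp

lemma expMeasure_laplace (c : ℝ≥0∞) :
    ∫⁻ x, expNeg (c * ENNReal.ofReal x) ∂(expMeasure 1) = (1 + c)⁻¹ := by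
  rw [lintegral_expMeasure _ (by fun_prop)]
  rcases eq_or_ne c ∞ with rfl | hc
  · simp only [add_top, ENNReal.inv_top]
    rw [setLIntegral_congr_fun (g := 0) measurableSet_Ioi]
    · simp
    · intro x hx
      have : ENNReal.ofReal x ≠ 0 := by simpa using hx
      simp [ENNReal.top_mul this]
  have h1 : ∀ x ∈ Set.Ioi (0 : ℝ), ENNReal.ofReal (Real.exp (-x)) *
      expNeg (c * ENNReal.ofReal x) =
      ENNReal.ofReal (Real.exp (-((1 + c.toReal) * x))) := by
    intro x hx
    have hx' : 0 < x := hx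
    conv_lhs => rw [← ENNReal.ofReal_toReal hc]
    rw [← ENNReal.ofReal_mul ENNReal.toReal_nonneg, expNeg_ofReal (by positivity),
      ← ENNReal.ofReal_mul (Real.exp_pos _).le, ← Real.exp_add]
    ring_nf
  have hpos : 0 < 1 + c.toReal := by positivity
  rw [setLIntegral_congr_fun measurableSet_Ioi h1, lintegral_Ioi_exp_neg_mul hpos]
  simp only [mul_zero, neg_zero, Real.exp_zero, one_div]
  rw [ENNReal.ofReal_inv_of_pos hpos, ENNReal.ofReal_add zero_le_one ENNReal.toReal_nonneg,
    ENNReal.ofReal_toReal hc, ENNReal.ofReal_one]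

/-- The Laplace transform of a weighted sum of independent exponential variables. -/
lemma lintegral_expNeg_tsum {Ω ι : Type*} [MeasurableSpace Ω] [Countable ι] {P : Measure Ω}
    {g : ι → Ω → ℝ} (hm : ∀ i, Measurable (g i)) (hl : ∀ i, HasLaw (g i) (expMeasure 1) P)
    (hi : iIndepFun g P) (c : ι → ℝ≥0∞) :
    ∫⁻ ω, expNeg (∑' i, c i * ENNReal.ofReal (g i ω)) ∂P = expNeg (∑' i, logOnePlus (c i)) := by
  have := hi.isProbabilityMeasure
  have hfin : ∀ s : Finset ι, ∫⁻ ω, expNeg (∑ i ∈ s, c i * ENNReal.ofReal (g i ω)) ∂P =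
      expNeg (∑ i ∈ s, logOnePlus (c i)) := by
    intro s
    simp only [expNeg_sum, expNeg_logOnePlus]
    have hms : ∀ i, Measurable fun x : ℝ => expNeg (c i * ENNReal.ofReal x) := fun i =>
      measurable_expNeg.comp (by fun_prop)
    rw [lintegral_prod_eq_prod_lintegral_of_indepFun s
      (fun i ω => expNeg (c i * ENNReal.ofReal (g i ω)))
      (hi.comp (fun i x => expNeg (c i * ENNReal.ofReal x)) hms) (fun i => (hms i).comp (hm i))]
    refine Finset.prod_congr rfl fun i _ => ?_
    rw [← expMeasure_laplace (c i), ← (hl i).map_eq, lintegral_map (hms i) (hm i)]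
  -- Finite sums exhaust the series, and the integrands are bounded by 1, so dominated convergence
  -- applies even when the series is infinite.
  have hlim1 : Tendsto (fun s : Finset ι => ∫⁻ ω, expNeg (∑ i ∈ s, c i * ENNReal.ofReal (g i ω)) ∂P)
      atTop (𝓝 (∫⁻ ω, expNeg (∑' i, c i * ENNReal.ofReal (g i ω)) ∂P)) := by
    refine tendsto_lintegral_filter_of_dominated_convergence (fun _ => 1) ?_ ?_ ?_ ?_
    · exact Eventually.of_forall fun s => measurable_expNeg.comp
        (Finset.measurable_sum _ fun i _ => ((hm i).ennreal_ofReal.const_mul _))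
    · exact Eventually.of_forall fun s => Eventually.of_forall fun ω => expNeg_le_one _
    · simp
    · exact Eventually.of_forall fun ω =>
        (continuous_expNeg.tendsto _).comp ENNReal.summable.hasSum
  have hlim2 : Tendsto (fun s : Finset ι => expNeg (∑ i ∈ s, logOnePlus (c i))) atTop
      (𝓝 (expNeg (∑' i, logOnePlus (c i)))) :=
    (continuous_expNeg.tendsto _).comp ENNReal.summable.hasSum
  simp only [hfin] at hlim1
  exact tendsto_nhds_unique hlim1 hlim2

/-- Measurability is asked only where the weight is nonzero, so that the sum is measurable for the
σ-algebra generated by the gains of the interferers alone, without the signal gain. -/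
lemma measurable_weighted_tsum {Ω ι : Type*} [MeasurableSpace Ω] [Countable ι]
    {g : ι → Ω → ℝ} {c : ι → ℝ≥0∞} (hm : ∀ i, c i ≠ 0 → Measurable (g i)) :
    Measurable fun ω => ∑' i, c i * ENNReal.ofReal (g i ω) := by
  refine Measurable.tsum fun i => ?_
  by_cases hi : c i = 0
  · simp [hi]
  · exact (hm i hi).ennreal_ofReal.const_mul _

/-- Success probability of an exponentially faded signal against exponentially faded
interference. -/
lemma measure_signal_gt {Ω ι : Type*} [MeasurableSpace Ω] [Countable ι] {P : Measure Ω}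
    {g : ι → Ω → ℝ} (hm : ∀ i, Measurable (g i)) (hl : ∀ i, HasLaw (g i) (expMeasure 1) P)
    (hi : iIndepFun g P) (c : ι → ℝ≥0∞) (κ : ℝ≥0∞) (i₀ : ι) (hc : c i₀ = 0) :
    P {ω | κ + ∑' i, c i * ENNReal.ofReal (g i ω) < ENNReal.ofReal (g i₀ ω)} =
      expNeg (κ + ∑' i, logOnePlus (c i)) := by
  have := hi.isProbabilityMeasure
  set W : Ω → ℝ≥0∞ := fun ω => ∑' i, c i * ENNReal.ofReal (g i ω) with hW
  have hWm : Measurable W := Measurable.tsum fun i => (hm i).ennreal_ofReal.const_mul _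
  -- As `c i₀ = 0`, the interference depends only on the gains with index other than `i₀`.
  have hind : IndepFun W (g i₀) P := by
    have h1 := indep_iSup_of_disjoint (m := fun i => MeasurableSpace.comap (g i) inferInstance)
      (fun i => (hm i).comap_le) hi (S := {i₀}ᶜ) (T := {i₀}) disjoint_compl_left
    rw [IndepFun_iff_Indep]
    refine indep_of_indep_of_le_left (indep_of_indep_of_le_right h1 ?_) ?_
    · simp
    · rw [← measurable_iff_comap_le]
      refine @measurable_weighted_tsum Ω ι
        (⨆ i ∈ ({i₀}ᶜ : Set ι), MeasurableSpace.comap (g i) inferInstance) _ g c fun i hii => ?_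
      · have hii : i ≠ i₀ := fun h => hii (h ▸ hc)
        have h2 : MeasurableSpace.comap (g i) inferInstance ≤
            ⨆ i ∈ ({i₀}ᶜ : Set ι), MeasurableSpace.comap (g i) inferInstance :=
          le_iSup₂_of_le i hii le_rfl
        exact measurable_iff_comap_le.2 h2
  have hset : MeasurableSet {p : ℝ≥0∞ × ℝ | κ + p.1 < ENNReal.ofReal p.2} :=
    measurableSet_lt (by fun_prop) (by fun_prop)
  have hms : MeasurableSet {ω | κ + W ω < ENNReal.ofReal (g i₀ ω)} :=
    measurableSet_lt (by fun_prop) ((hm i₀).ennreal_ofReal)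
  calc P {ω | κ + W ω < ENNReal.ofReal (g i₀ ω)}
      = ∫⁻ ω, {p : ℝ≥0∞ × ℝ | κ + p.1 < ENNReal.ofReal p.2}.indicator 1 (W ω, g i₀ ω) ∂P := by
        rw [← lintegral_indicator_one hms]; rfl
    _ = ∫⁻ ω, ∫⁻ ω', {p : ℝ≥0∞ × ℝ | κ + p.1 < ENNReal.ofReal p.2}.indicator 1
          (W ω, g i₀ ω') ∂P ∂P :=
        lintegral_indepFun_eq hWm (hm i₀) hind (measurable_one.indicator hset)
    _ = ∫⁻ ω, expNeg (κ + W ω) ∂P := by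
        refine lintegral_congr fun ω => ?_
        rw [← expMeasure_tail, ← (hl i₀).map_eq, lintegral_map _ (hm i₀)]
        · rfl
        · exact measurable_one.indicator
            (measurableSet_lt measurable_const ENNReal.measurable_ofReal)
    _ = expNeg (κ + ∑' i, logOnePlus (c i)) := by
        simp only [expNeg_add]
        rw [lintegral_const_mul _ hWm.expNeg, lintegral_expNeg_tsum hm hl hi c]

/-! ### Poisson point processes -/

lemma lintegral_poissonMeasure (r : ℝ≥0) (f : ℕ → ℝ≥0∞) :
    ∫⁻ k, f k ∂(poissonMeasure r) =
      ∑' k : ℕ, ENNReal.ofReal (Real.exp (-r) * r ^ k / k.factorial) * f k := by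
  unfold poissonMeasure
  rw [lintegral_sum_measure]
  refine tsum_congr fun k => ?_
  rw [lintegral_smul_measure, lintegral_dirac, smul_eq_mul]

lemma tsum_indicator_pointCount (x : ℕ → Plane) (B : Set Plane) (c : ℝ≥0∞) :
    ∑' j, B.indicator (fun _ => c) (x j) = c * (pointCount x B : ℝ≥0∞) := by
  unfold pointCount
  rw [← ENNReal.tsum_set_one, ENNReal.tsum_mul_left.symm, tsum_subtype {n | x n ∈ B} (fun _ => c * 1)]
  refine tsum_congr fun j => ?_
  simp [Set.indicator]

namespace IsHomogeneousPPP

variable {Ω : Type*} [MeasurableSpace Ω] {P : Measure Ω} {X : ℕ → Ω → Plane} {lam : ℝ}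

lemma lintegral_pointCount (h : IsHomogeneousPPP P X lam) {B : Set Plane} (hB : MeasurableSet B)
    (hb : Bornology.IsBounded B) (f : ℕ∞ → ℝ≥0∞) :
    ∫⁻ ω, f (pointCount (fun n => X n ω) B) ∂P =
      ∫⁻ k, f (k : ℕ) ∂(poissonMeasure (ENNReal.ofReal lam * volume B).toNNReal) := by
  have hl := h.count_law B hB hb
  have hf : Measurable f := measurable_of_countable f
  rw [← lintegral_map' (f := f) hf.aemeasurable hl.aemeasurable, hl.map_eq,
    lintegral_map hf (measurable_of_countable _)]

/-- The probability generating function E z^N = e^(-m(1-z)) of a Poisson variable at z = e^(-c); `c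
= ∞` corresponds to z = 0. -/
lemma lintegral_expNeg_pointCount (h : IsHomogeneousPPP P X lam) {B : Set Plane}
    (hB : MeasurableSet B) (hb : Bornology.IsBounded B) (c : ℝ≥0∞) :
    ∫⁻ ω, expNeg (c * (pointCount (fun n => X n ω) B : ℝ≥0∞)) ∂P =
      expNeg (ENNReal.ofReal lam * volume B * (1 - expNeg c)) := by
  rw [h.lintegral_pointCount hB hb (fun n => expNeg (c * (n : ℝ≥0∞))), lintegral_poissonMeasure]
  have hfin : ENNReal.ofReal lam * volume B ≠ ∞ :=
    ENNReal.mul_ne_top ENNReal.ofReal_ne_top hb.measure_lt_top.ne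
  set m := (ENNReal.ofReal lam * volume B).toNNReal with hm
  have hm' : ENNReal.ofReal lam * volume B = ENNReal.ofReal (m : ℝ) := by
    rw [ENNReal.ofReal_coe_nnreal, hm, ENNReal.coe_toNNReal hfin]
  have hE : expNeg c ≠ ∞ := ((expNeg_le_one c).trans_lt ENNReal.one_lt_top).ne
  obtain ⟨z, hz0, hz1, hz⟩ : ∃ z : ℝ, 0 ≤ z ∧ z ≤ 1 ∧ expNeg c = ENNReal.ofReal z :=
    ⟨(expNeg c).toReal, ENNReal.toReal_nonneg,
      ENNReal.toReal_le_of_le_ofReal zero_le_one (by simpa using expNeg_le_one c),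
      (ENNReal.ofReal_toReal hE).symm⟩
  have hk : ∀ k : ℕ, expNeg (c * (((k : ℕ) : ℕ∞) : ℝ≥0∞)) = ENNReal.ofReal (z ^ k) := by
    intro k
    rw [ENNReal.ofReal_pow hz0, ← hz]
    induction k with
    | zero => simp
    | succ k ih =>
      rw [pow_succ, ← ih, ← expNeg_add]
      push_cast
      ring_nf
  have hsum : HasSum (fun k : ℕ => Real.exp (-m) * m ^ k / k.factorial * z ^ k)
      (Real.exp (-(m * (1 - z)))) := by
    have h1 := (NormedSpace.expSeries_div_hasSum_exp (𝔸 := ℝ) (m * z : ℝ)).mul_left (Real.exp (-m))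
    rw [← Real.exp_eq_exp_ℝ, ← Real.exp_add] at h1
    have h2 : -(m * (1 - z)) = -(m : ℝ) + m * z := by ring
    rw [h2]
    refine h1.congr_fun ?_
    intro k
    rw [mul_pow]
    ring
  simp only [hk]
  have hmz : 0 ≤ (m : ℝ) * (1 - z) := mul_nonneg m.2 (by linarith)
  rw [hm', hz, ← ENNReal.ofReal_one, ← ENNReal.ofReal_sub _ hz0, ← ENNReal.ofReal_mul (by positivity),
    expNeg_ofReal hmz, ← hsum.tsum_eq,
    ENNReal.ofReal_tsum_of_nonneg (fun k => by positivity) hsum.summable]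
  refine tsum_congr fun k => ?_
  rw [ENNReal.ofReal_mul (p := Real.exp (-m) * m ^ k / k.factorial) (by positivity)]

lemma lintegral_expNeg_sum_pointCount [IsProbabilityMeasure P] (h : IsHomogeneousPPP P X lam)
    {ι : Type*} (T : Finset ι) {B : ι → Set Plane}
    (hB : ∀ k ∈ T, MeasurableSet (B k)) (hb : ∀ k ∈ T, Bornology.IsBounded (B k))
    (hd : (T : Set ι).PairwiseDisjoint B) (c : ι → ℝ≥0∞) :
    ∫⁻ ω, expNeg (∑ k ∈ T, c k * (pointCount (fun n => X n ω) (B k) : ℝ≥0∞)) ∂P =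
      expNeg (ENNReal.ofReal lam * ∑ k ∈ T, volume (B k) * (1 - expNeg (c k))) := by
  set e := T.equivFin.symm
  have hre : ∀ f : ι → ℝ≥0∞, ∑ k ∈ T, f k = ∑ k, f (e k) := by
    intro f
    rw [← Finset.sum_coe_sort, ← e.sum_comp]
  have hind := h.count_indep T.card (fun k => B (e k)) (fun k => hB _ (e k).2)
    (fun k => hb _ (e k).2)
    (fun k l hkl => hd (e k).2 (e l).2 fun h => hkl (e.injective (Subtype.ext h)))
  have hae : ∀ k, AEMeasurable (fun ω => pointCount (fun n => X n ω) (B (e k))) P := fun k =>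
    (h.count_law _ (hB _ (e k).2) (hb _ (e k).2)).aemeasurable
  simp only [hre, Finset.mul_sum, expNeg_sum]
  have hind' := hind.comp (fun k n => expNeg (c (e k) * (n : ℝ≥0∞)))
    (fun k => measurable_of_countable _)
  have hae' : ∀ k, AEMeasurable (fun ω => expNeg (c (e k) *
      (pointCount (fun n => X n ω) (B (e k)) : ℝ≥0∞))) P := fun k =>
    (measurable_of_countable (fun n : ℕ∞ => expNeg (c (e k) * (n : ℝ≥0∞)))).comp_aemeasurable (hae k)
  -- The count laws supply only a.e. measurability, so the product formula is applied to measurable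
  -- versions.
  have hcongr : ∀ k, (fun ω => expNeg (c (e k) *
      (pointCount (fun n => X n ω) (B (e k)) : ℝ≥0∞))) =ᵐ[P] (hae' k).mk := fun k => (hae' k).ae_eq_mk
  have hprod := lintegral_prod_eq_prod_lintegral_of_indepFun Finset.univ (fun k => (hae' k).mk)
    (hind'.congr hcongr) (fun k => (hae' k).measurable_mk)
  have hall := ae_all_iff.2 hcongr
  rw [lintegral_congr_ae (g := fun ω => ∏ k, (hae' k).mk _ ω), hprod]
  · refine Finset.prod_congr rfl fun k _ => ?_
    rw [← lintegral_congr_ae (hcongr k),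
      h.lintegral_expNeg_pointCount (hB _ (e k).2) (hb _ (e k).2), mul_assoc]
  · filter_upwards [hall] with ω hω
    exact Finset.prod_congr rfl fun k _ => hω k

lemma lintegral_expNeg_tsum_simpleFunc [IsProbabilityMeasure P] (h : IsHomogeneousPPP P X lam)
    (ψ : SimpleFunc Plane ℝ≥0∞) (hψ : Bornology.IsBounded (Function.support ψ)) :
    ∫⁻ ω, expNeg (∑' j, ψ (X j ω)) ∂P =
      expNeg (ENNReal.ofReal lam * ∫⁻ y, (1 - expNeg (ψ y))) := by
  classical
  -- The value 0 is left out: its fibre is unbounded and contributes nothing to either side.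
  set T := ψ.range.filter (· ≠ 0) with hT
  have hsub : ∀ c ∈ T, ψ ⁻¹' {c} ⊆ Function.support ψ := by
    intro c hc y hy
    have : c ≠ 0 := (Finset.mem_filter.1 hc).2
    rw [Set.mem_preimage, Set.mem_singleton_iff] at hy
    rwa [Function.mem_support, hy]
  have key := h.lintegral_expNeg_sum_pointCount T (B := fun c => ψ ⁻¹' {c})
    (fun c _ => ψ.measurableSet_fiber c) (fun c hc => hψ.subset (hsub c hc))
    (fun c _ d _ hcd => Set.disjoint_left.2 fun y hy hy' => hcd (by
      simp only [Set.mem_preimage, Set.mem_singleton_iff] at hy hy'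
      exact hy.symm.trans hy')) id
  have hL : ∀ ω, ∑' j, ψ (X j ω) =
      ∑ c ∈ T, id c * (pointCount (fun n => X n ω) (ψ ⁻¹' {c}) : ℝ≥0∞) := by
    intro ω
    simp only [← tsum_indicator_pointCount]
    rw [← Summable.tsum_finsetSum fun _ _ => ENNReal.summable]
    refine tsum_congr fun j => ?_
    simp only [Set.indicator, Set.mem_preimage, Set.mem_singleton_iff, id]
    rw [Finset.sum_ite_eq]
    split_ifs with hmem
    · rfl
    · by_contra hne
      exact hmem (Finset.mem_filter.2 ⟨ψ.mem_range_self _, hne⟩)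
  have hR : ∫⁻ y, (1 - expNeg (ψ y)) = ∑ c ∈ T, volume (ψ ⁻¹' {c}) * (1 - expNeg (id c)) := by
    have h1 : ∫⁻ y, (1 - expNeg (ψ y)) = (ψ.map fun c => 1 - expNeg c).lintegral volume := by
      rw [← SimpleFunc.lintegral_eq_lintegral]; rfl
    rw [h1, SimpleFunc.map_lintegral, hT, Finset.sum_filter]
    refine Finset.sum_congr rfl fun c _ => ?_
    split_ifs with hc
    · rw [mul_comm]; rfl
    · rw [not_not] at hc
      simp [hc]
  rw [hR, ← key]
  exact lintegral_congr fun ω => by rw [hL]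

/-- The Laplace functional of a homogeneous Poisson process, as a lower bound. -/
lemma expNeg_le_lintegral_expNeg_tsum [IsProbabilityMeasure P] (h : IsHomogeneousPPP P X lam)
    {ψ : Plane → ℝ≥0∞} (hψ : Measurable ψ) :
    expNeg (ENNReal.ofReal lam * ∫⁻ y, (1 - expNeg (ψ y))) ≤
      ∫⁻ ω, expNeg (∑' j, ψ (X j ω)) ∂P := by
  -- Increasing simple approximations, cut off to balls because the process is described only on
  -- bounded sets.
  set ψn : ℕ → SimpleFunc Plane ℝ≥0∞ := fun n =>
    (SimpleFunc.eapprox ψ n).restrict (Metric.ball 0 n) with hψn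
  have happ : ∀ n y, ψn n y = (Metric.ball (0 : Plane) n).indicator (SimpleFunc.eapprox ψ n) y :=
    fun n y => SimpleFunc.restrict_apply _ Metric.isOpen_ball.measurableSet y
  have hle : ∀ n y, ψn n y ≤ ψ y := by
    intro n y
    rw [happ]
    refine (Set.indicator_le_self _ _ _).trans ?_
    rw [← SimpleFunc.iSup_eapprox_apply hψ y]
    exact le_iSup (fun n => SimpleFunc.eapprox ψ n y) n
  have hmono : ∀ y, Monotone fun n => ψn n y := by
    intro y m n hmn
    simp only [happ]
    refine (Set.indicator_le_indicator_of_subset (Metric.ball_subset_ball (by exact_mod_cast hmn))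
      (fun _ => zero_le) y).trans (Set.indicator_le_indicator ?_)
    exact SimpleFunc.monotone_eapprox ψ hmn y
  have hlim : ∀ y, Tendsto (fun n => ψn n y) atTop (𝓝 (ψ y)) := by
    intro y
    have h1 : Tendsto (fun n => SimpleFunc.eapprox ψ n y) atTop (𝓝 (ψ y)) := by
      rw [← SimpleFunc.iSup_eapprox_apply hψ y]
      exact tendsto_atTop_iSup fun m n hmn => SimpleFunc.monotone_eapprox ψ hmn y
    refine h1.congr' ?_
    obtain ⟨N, hN⟩ := exists_nat_gt ‖y‖
    filter_upwards [eventually_ge_atTop N] with n hn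
    rw [happ, Set.indicator_of_mem]
    rw [mem_ball_zero_iff]
    exact hN.trans_le (by exact_mod_cast hn)
  have hsum : ∀ ω, Tendsto (fun n => ∑' j, ψn n (X j ω)) atTop (𝓝 (∑' j, ψ (X j ω))) := by
    intro ω
    simp only [← lintegral_count]
    exact lintegral_tendsto_of_tendsto_of_monotone
      (fun n => (measurable_of_countable _).aemeasurable)
      (Eventually.of_forall fun j => hmono _) (Eventually.of_forall fun j => hlim _)
  have hlimI : Tendsto (fun n => ∫⁻ ω, expNeg (∑' j, ψn n (X j ω)) ∂P) atTop
      (𝓝 (∫⁻ ω, expNeg (∑' j, ψ (X j ω)) ∂P)) := by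
    refine tendsto_lintegral_filter_of_dominated_convergence (fun _ => 1) ?_ ?_ ?_ ?_
    · exact Eventually.of_forall fun n => Measurable.expNeg
        (Measurable.tsum fun j => (ψn n).measurable.comp (h.measurable j))
    · exact Eventually.of_forall fun s => Eventually.of_forall fun ω => expNeg_le_one _
    · simp
    · exact Eventually.of_forall fun ω => (continuous_expNeg.tendsto _).comp (hsum ω)
  -- For the lower bound the exponent needs no limit: `ψn n ≤ ψ` makes its integral at most that of
  -- `ψ` for every `n`.
  refine ge_of_tendsto' hlimI fun n => ?_
  rw [h.lintegral_expNeg_tsum_simpleFunc]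
  · refine antitone_expNeg ?_
    gcongr with y
    exact antitone_expNeg (hle n y)
  · refine (Metric.isBounded_ball (x := (0 : Plane)) (r := n)).subset fun y hy => ?_
    by_contra hny
    rw [Function.mem_support, happ, Set.indicator_of_notMem hny] at hy
    exact hy rfl

end IsHomogeneousPPP

/-! ### Measurability of counts and of the association -/

lemma measurable_pointCount {B : Set Plane} (hB : MeasurableSet B) :
    Measurable fun x : ℕ → Plane => pointCount x B := by
  have h1 : Measurable fun x : ℕ → Plane => (pointCount x B : ℝ≥0∞) := by
    have h2 : (fun x : ℕ → Plane => (pointCount x B : ℝ≥0∞)) =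
        fun x => ∑' j, B.indicator (fun _ => 1) (x j) := by
      ext x
      rw [tsum_indicator_pointCount, one_mul]
    rw [h2]
    exact Measurable.tsum fun j => (measurable_const.indicator hB).comp (measurable_pi_apply j)
  refine measurable_to_countable' fun n => ?_
  have h3 : (fun x : ℕ → Plane => pointCount x B) ⁻¹' {n} =
      (fun x : ℕ → Plane => (pointCount x B : ℝ≥0∞)) ⁻¹' {(n : ℝ≥0∞)} := by
    ext x
    simp
  rw [h3]
  exact h1 (measurableSet_singleton _)

lemma pointCount_eq_zero {x : ℕ → Plane} {B : Set Plane} :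
    pointCount x B = 0 ↔ ∀ j, x j ∉ B := by
  unfold pointCount
  rw [Set.encard_eq_zero, Set.eq_empty_iff_forall_notMem]
  rfl

lemma pointCount_eq_one {x : ℕ → Plane} {B : Set Plane} :
    pointCount x B = 1 ↔ ∃ i, ∀ j, x j ∈ B ↔ j = i := by
  unfold pointCount
  rw [Set.encard_eq_one]
  simp [Set.ext_iff]

lemma measurableSet_isNearest (i : ℕ) :
    MeasurableSet {p : (ℕ → Plane) × Plane | IsNearest p.1 p.2 i} := by
  unfold IsNearest
  simp only [Set.ofPred_forall]
  exact MeasurableSet.iInter fun j => measurableSet_le (by fun_prop) (by fun_prop)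

lemma isNearest_assoc {x : ℕ → Plane} {p : Plane} (h : ∃ i, IsNearest x p i) :
    IsNearest x p (assoc x p) := by
  classical
  unfold assoc
  rw [dif_pos h]
  exact Nat.find_spec h

lemma measurable_assoc : Measurable fun p : (ℕ → Plane) × Plane => assoc p.1 p.2 := by
  classical
  refine measurable_to_countable' fun n => ?_
  -- The second part of the union is the default value 0, taken when no nearest point exists.
  have hset : (fun p : (ℕ → Plane) × Plane => assoc p.1 p.2) ⁻¹' {n} =
      ({p | IsNearest p.1 p.2 n} ∩ ⋂ m, ⋂ (_ : m < n), {p | IsNearest p.1 p.2 m}ᶜ) ∪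
      ({_p | n = 0} ∩ ⋂ m, {p | IsNearest p.1 p.2 m}ᶜ) := by
    ext p
    simp only [Set.mem_preimage, Set.mem_singleton_iff, Set.mem_union, Set.mem_inter_iff,
      Set.mem_ofPred_eq, Set.mem_iInter, Set.mem_compl_iff]
    unfold assoc
    by_cases h : ∃ i, IsNearest p.1 p.2 i
    · rw [dif_pos h, Nat.find_eq_iff]
      have : ¬ ∀ i, ¬ IsNearest p.1 p.2 i := by simpa using h
      tauto
    · rw [dif_neg h]
      have h' : ∀ i, ¬ IsNearest p.1 p.2 i := by simpa using h
      constructor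
      · exact fun h0 => Or.inr ⟨h0.symm, h'⟩
      · rintro (h0 | h0)
        · exact absurd h0.1 (h' n)
        · exact h0.1.symm
  rw [hset]
  refine MeasurableSet.union ((measurableSet_isNearest n).inter ?_)
    (MeasurableSet.inter (MeasurableSet.const _) ?_)
  · exact MeasurableSet.iInter fun m => MeasurableSet.iInter fun _ => (measurableSet_isNearest m).compl
  · exact MeasurableSet.iInter fun m => (measurableSet_isNearest m).compl

lemma measurable_assoc_comp {E : Type*} [MeasurableSpace E] {f : E → ℕ → Plane} {p : E → Plane}
    (hf : Measurable f) (hp : Measurable p) : Measurable fun e => assoc (f e) (p e) := by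
  have h : Measurable fun e => (f e, p e) := hf.prodMk hp
  have h2 := measurable_assoc.comp h
  simp only [Function.comp_def] at h2
  exact h2

lemma measurable_apply_nat {E F : Type*} [MeasurableSpace E] [MeasurableSpace F]
    {f : E → ℕ → F} {n : E → ℕ} (hf : Measurable f) (hn : Measurable n) :
    Measurable fun e => f e (n e) := by
  have h : Measurable fun p : ℕ × (ℕ → F) => p.2 p.1 :=
    measurable_from_prod_countable_right fun n => measurable_pi_apply n
  exact h.comp (hn.prodMk hf)

/-! ### Exactly one point in a set and none in another -/

/-- No point lies in `V` and exactly one lies in `B`. -/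
def VoidOne (V B : Set Plane) (x : ℕ → Plane) : Prop := pointCount x V = 0 ∧ pointCount x B = 1

lemma measurableSet_voidOne {V B : Set Plane} (hV : MeasurableSet V) (hB : MeasurableSet B) :
    MeasurableSet {x | VoidOne V B x} :=
  (measurable_pointCount hV (measurableSet_singleton 0)).inter
    (measurable_pointCount hB (measurableSet_singleton 1))

namespace IsHomogeneousPPP

variable {Ω : Type*} [MeasurableSpace Ω] {P : Measure Ω} {X : ℕ → Ω → Plane} {lam : ℝ}

lemma measurable_pi (h : IsHomogeneousPPP P X lam) : Measurable fun ω n => X n ω :=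
  measurable_pi_lambda _ h.measurable

lemma measure_pointCount_eq (h : IsHomogeneousPPP P X lam) {B : Set Plane} (hB : MeasurableSet B)
    (hb : Bornology.IsBounded B) (k : ℕ) :
    P {ω | pointCount (fun n => X n ω) B = k} = ENNReal.ofReal
      (Real.exp (-(ENNReal.ofReal lam * volume B).toReal) *
        (ENNReal.ofReal lam * volume B).toReal ^ k / k.factorial) := by
  rw [(h.count_law B hB hb).measure_eq (p := fun n => n = (k : ℕ∞)) (MeasurableSet.of_discrete),
    Measure.map_apply (measurable_of_countable _) MeasurableSet.of_discrete]
  have : (fun n : ℕ => (n : ℕ∞)) ⁻¹' {x | x = (k : ℕ∞)} = {k} := by ext; simp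
  rw [this, poissonMeasure_singleton]
  rfl

/-- Independence gives e^(-λ|V|) · λ|B| e^(-λ|B|), and the two exponentials merge. -/
lemma measure_voidOne (h : IsHomogeneousPPP P X lam) {V B : Set Plane}
    (hV : MeasurableSet V) (hB : MeasurableSet B) (hVb : Bornology.IsBounded V)
    (hBb : Bornology.IsBounded B) (hd : Disjoint V B) :
    P {ω | VoidOne V B fun n => X n ω} =
      expNeg (ENNReal.ofReal lam * volume (V ∪ B)) * (ENNReal.ofReal lam * volume B) := by
  have hind := h.count_indep 2 ![V, B] (by simp [Fin.forall_fin_two, hV, hB])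
    (by simp [Fin.forall_fin_two, hVb, hBb])
    (by intro k l hkl; fin_cases k <;> fin_cases l <;> simp_all [disjoint_comm])
  have h1 := hind.measure_inter_preimage_eq_mul Finset.univ (sets := ![{0}, {1}])
    (fun _ _ => MeasurableSet.of_discrete)
  have h2 : (⋂ i ∈ (Finset.univ : Finset (Fin 2)),
      (fun ω => pointCount (fun n => X n ω) (![V, B] i)) ⁻¹' (![{0}, {1}] : Fin 2 → Set ℕ∞) i) =
      {ω | VoidOne V B fun n => X n ω} := by
    ext ω
    simp [VoidOne, Fin.forall_fin_two]
  rw [h2, Fin.prod_univ_two] at h1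
  have hz := h.measure_pointCount_eq hV hVb 0
  have ho := h.measure_pointCount_eq hB hBb 1
  have h3 : P {ω | VoidOne V B fun n => X n ω} =
      P {ω | pointCount (fun n => X n ω) V = (0 : ℕ)} *
      P {ω | pointCount (fun n => X n ω) B = (1 : ℕ)} := by
    rw [h1]
    simp only [Nat.cast_zero, Nat.cast_one]
    rfl
  have hfV : ENNReal.ofReal lam * volume V ≠ ∞ :=
    ENNReal.mul_ne_top ENNReal.ofReal_ne_top hVb.measure_lt_top.ne
  have hfB : ENNReal.ofReal lam * volume B ≠ ∞ :=
    ENNReal.mul_ne_top ENNReal.ofReal_ne_top hBb.measure_lt_top.ne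
  rw [h3, hz, ho, measure_union hd hB, mul_add, expNeg_add]
  simp only [pow_zero, mul_one, Nat.factorial_zero, Nat.cast_one, div_one, pow_one,
    Nat.factorial_one]
  rw [ENNReal.ofReal_mul (Real.exp_pos _).le, ← expNeg_ofReal ENNReal.toReal_nonneg,
    ← expNeg_ofReal ENNReal.toReal_nonneg, ENNReal.ofReal_toReal hfV, ENNReal.ofReal_toReal hfB,
    mul_assoc]

/-- The two events are read off from counts in four pairwise disjoint sets. -/
lemma measure_voidOne_inter (h : IsHomogeneousPPP P X lam) {V B V' B' : Set Plane}
    (hV : MeasurableSet V) (hB : MeasurableSet B) (hV' : MeasurableSet V') (hB' : MeasurableSet B')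
    (hVb : Bornology.IsBounded V) (hBb : Bornology.IsBounded B)
    (hVb' : Bornology.IsBounded V') (hBb' : Bornology.IsBounded B')
    (hd : Disjoint V B) (hd' : Disjoint V' B') (hdd : Disjoint (V ∪ B) (V' ∪ B')) :
    P {ω | (VoidOne V B fun n => X n ω) ∧ VoidOne V' B' fun n => X n ω} =
      P {ω | VoidOne V B fun n => X n ω} * P {ω | VoidOne V' B' fun n => X n ω} := by
  simp only [Set.disjoint_union_left, Set.disjoint_union_right] at hdd
  obtain ⟨⟨h1, h2⟩, h3, h4⟩ := hdd
  have hind := h.count_indep 4 ![V, B, V', B']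
    (by intro k; fin_cases k <;> simpa) (by intro k; fin_cases k <;> simpa)
    (by intro k l hkl; fin_cases k <;> fin_cases l <;> simp_all [disjoint_comm])
  have hp : ∀ s : Finset (Fin 4), _ := fun s =>
    hind.measure_inter_preimage_eq_mul s (sets := ![{0}, {1}, {0}, {1}])
      (fun _ _ => MeasurableSet.of_discrete)
  have e1 := hp Finset.univ
  have e2 := hp {0, 1}
  have e3 := hp {2, 3}
  rw [Fin.prod_univ_four] at e1
  rw [Finset.prod_pair (by decide)] at e2 e3
  have s1 : {ω | (VoidOne V B fun n => X n ω) ∧ VoidOne V' B' fun n => X n ω} =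
      (⋂ i ∈ (Finset.univ : Finset (Fin 4)),
      (fun ω => pointCount (fun n => X n ω) (![V, B, V', B'] i)) ⁻¹'
        (![{0}, {1}, {0}, {1}] : Fin 4 → Set ℕ∞) i) := by
    ext ω
    simp only [VoidOne, Set.mem_ofPred_eq, Finset.mem_univ, Set.iInter_true, Set.mem_iInter,
      Fin.forall_fin_succ]
    simp [and_assoc]
  have s2 : {ω | VoidOne V B fun n => X n ω} =
      (⋂ i ∈ ({0, 1} : Finset (Fin 4)),
      (fun ω => pointCount (fun n => X n ω) (![V, B, V', B'] i)) ⁻¹'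
        (![{0}, {1}, {0}, {1}] : Fin 4 → Set ℕ∞) i) := by
    ext ω
    simp [VoidOne]
  have s3 : {ω | VoidOne V' B' fun n => X n ω} =
      (⋂ i ∈ ({2, 3} : Finset (Fin 4)),
      (fun ω => pointCount (fun n => X n ω) (![V, B, V', B'] i)) ⁻¹'
        (![{0}, {1}, {0}, {1}] : Fin 4 → Set ℕ∞) i) := by
    ext ω
    simp [VoidOne]
  rw [s1, s2, s3, e1, e2, e3, mul_assoc, mul_assoc]

end IsHomogeneousPPP

/-! ### The nearest point of a Poisson process outside a ball -/

/-- The radius of a disc of area `v`. -/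
def discRadius (v : ℝ) : ℝ := √(v / Real.pi)

lemma volume_ball_discRadius (y : Plane) {v : ℝ} (hv : 0 ≤ v) :
    volume (Metric.ball y (discRadius v)) = ENNReal.ofReal v := by
  rw [InnerProductSpace.volume_ball_of_dim_even (k := 1) (by simp), discRadius]
  simp only [finrank_euclideanSpace, Fintype.card_fin, pow_one, Nat.factorial_one, Nat.cast_one, div_one]
  rw [← ENNReal.ofReal_pow (Real.sqrt_nonneg _), ← ENNReal.ofReal_mul (by positivity),
    Real.sq_sqrt (div_nonneg hv Real.pi_pos.le), div_mul_cancel₀ _ Real.pi_pos.ne']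

lemma discRadius_mono : Monotone discRadius := fun _ _ h =>
  Real.sqrt_le_sqrt (div_le_div_of_nonneg_right h Real.pi_pos.le)

lemma discRadius_pos {v : ℝ} (hv : 0 < v) : 0 < discRadius v :=
  Real.sqrt_pos.2 (div_pos hv Real.pi_pos)

lemma discRadius_sq {v : ℝ} (hv : 0 ≤ v) : Real.pi * discRadius v ^ 2 = v := by
  rw [discRadius, Real.sq_sqrt (div_nonneg hv Real.pi_pos.le), mul_div_cancel₀ _ Real.pi_pos.ne']

lemma discRadius_le_iff {v d : ℝ} (hd : 0 ≤ d) : discRadius v ≤ d ↔ v ≤ Real.pi * d ^ 2 := by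
  rw [discRadius, Real.sqrt_le_left hd, div_le_iff₀' Real.pi_pos]

/-- The law of the point nearest to `y` of a Poisson process of intensity `lam`. -/
def nearestLaw (lam : ℝ) (y : Plane) : Measure Plane :=
  volume.withDensity fun z => ENNReal.ofReal (lam * Real.exp (-(lam * (Real.pi * ‖z - y‖ ^ 2))))

/-- In the plane the void probability of a disc is Gaussian in its radius, so the nearest-point
density is a normalised Gaussian. -/
lemma lintegral_gaussian {lam : ℝ} (hl : 0 < lam) :
    ∫⁻ z : Plane, ENNReal.ofReal (lam * Real.exp (-(lam * (Real.pi * ‖z‖ ^ 2)))) = 1 := by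
  have hb : 0 < lam * Real.pi := by positivity
  have h := GaussianFourier.integral_rexp_neg_mul_sq_norm (V := Plane) hb
  have h1 : ∀ z : Plane, -(lam * Real.pi) * ‖z‖ ^ 2 = -(lam * (Real.pi * ‖z‖ ^ 2)) := fun z => by ring
  simp only [h1, finrank_euclideanSpace, Fintype.card_fin, Nat.cast_ofNat, div_self (two_ne_zero' ℝ),
    Real.rpow_one] at h
  have hint : Integrable fun z : Plane => Real.exp (-(lam * (Real.pi * ‖z‖ ^ 2))) := by
    refine Integrable.of_integral_ne_zero ?_
    rw [h]
    positivity
  rw [← ofReal_integral_eq_lintegral_ofReal (hint.const_mul _)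
    (Eventually.of_forall fun z => by positivity), integral_const_mul, h]
  rw [← ENNReal.ofReal_one]
  congr 1
  field_simp

lemma nearestLaw_univ {lam : ℝ} (hl : 0 < lam) (y : Plane) : nearestLaw lam y Set.univ = 1 := by
  unfold nearestLaw
  rw [withDensity_apply _ MeasurableSet.univ, Measure.restrict_univ, ← lintegral_gaussian hl]
  exact lintegral_sub_right_eq_self (μ := (volume : Measure Plane))
    (fun z => ENNReal.ofReal (lam * Real.exp (-(lam * (Real.pi * ‖z‖ ^ 2))))) y

/-- The annulus of area `δ` around `y` with inner area `k * δ`. -/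
def annulus (y : Plane) (δ : ℝ) (k : ℕ) : Set Plane :=
  Metric.ball y (discRadius ((k + 1 : ℕ) * δ)) \ Metric.ball y (discRadius (k * δ))

lemma measurableSet_annulus (y : Plane) (δ : ℝ) (k : ℕ) : MeasurableSet (annulus y δ k) :=
  Metric.isOpen_ball.measurableSet.diff Metric.isOpen_ball.measurableSet

lemma ball_discRadius_mono (y : Plane) {δ : ℝ} (hδ : 0 < δ) {k l : ℕ} (h : k ≤ l) :
    Metric.ball y (discRadius (k * δ)) ⊆ Metric.ball y (discRadius (l * δ)) := by
  refine Metric.ball_subset_ball (discRadius_mono ?_)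
  gcongr

lemma ball_union_annulus (y : Plane) {δ : ℝ} (hδ : 0 < δ) (k : ℕ) :
    Metric.ball y (discRadius (k * δ)) ∪ annulus y δ k =
      Metric.ball y (discRadius ((k + 1 : ℕ) * δ)) :=
  Set.union_sdiff_cancel (ball_discRadius_mono y hδ k.le_succ)

lemma pairwise_disjoint_annulus (y : Plane) {δ : ℝ} (hδ : 0 < δ) :
    Pairwise fun k l => Disjoint (annulus y δ k) (annulus y δ l) := by
  have key : ∀ k l, k < l → Disjoint (annulus y δ k) (annulus y δ l) := fun k l hkl =>
    Set.disjoint_left.2 fun z hz hz' => hz'.2 (ball_discRadius_mono y hδ hkl hz.1)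
  intro k l hkl
  rcases lt_or_gt_of_ne hkl with h | h
  · exact key k l h
  · exact (key l k h).symm

lemma iUnion_annulus (y : Plane) {δ : ℝ} (hδ : 0 < δ) : ⋃ k, annulus y δ k = Set.univ := by
  -- The annulus containing `z` is found by dividing the area of the disc reaching to `z` by `δ`.
  refine Set.eq_univ_of_forall fun z => Set.mem_iUnion.2 ⟨⌊Real.pi * dist z y ^ 2 / δ⌋₊, ?_⟩
  have h0 : 0 ≤ Real.pi * dist z y ^ 2 / δ := by positivity
  have h1 := Nat.floor_le h0
  have h2 := Nat.lt_floor_add_one (Real.pi * dist z y ^ 2 / δ)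
  rw [le_div_iff₀ hδ] at h1
  rw [div_lt_iff₀ hδ] at h2
  constructor
  · rw [Metric.mem_ball, ← not_le, discRadius_le_iff dist_nonneg, not_le]
    exact_mod_cast h2
  · rw [Metric.mem_ball, not_lt, discRadius_le_iff dist_nonneg]
    exact h1

/-- A Poisson process has no point in `V`, contained in the disc up to the outer boundary of an
annulus, and one in the part `B` of that annulus, with probability comparable to that of the
nearest point to `y` lying in `B`. -/
lemma IsHomogeneousPPP.nearestLaw_le_measure_voidOne {Ω : Type*} [MeasurableSpace Ω] {P : Measure Ω}
    {X : ℕ → Ω → Plane} {lam : ℝ} (h : IsHomogeneousPPP P X lam) (hl : 0 < lam) (y : Plane)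
    {δ : ℝ} (hδ : 0 < δ) (k : ℕ) {V B : Set Plane} (hV : MeasurableSet V) (hB : MeasurableSet B)
    (hd : Disjoint V B) (hVB : V ∪ B ⊆ Metric.ball y (discRadius ((k + 1 : ℕ) * δ)))
    (hBA : B ⊆ annulus y δ k) :
    ENNReal.ofReal (Real.exp (-(lam * δ))) * nearestLaw lam y B ≤
      P {ω | VoidOne V B fun n => X n ω} := by
  have hVb : Bornology.IsBounded V := Metric.isBounded_ball.subset (Set.subset_union_left.trans hVB)
  have hBb : Bornology.IsBounded B := Metric.isBounded_ball.subset (Set.subset_union_right.trans hVB)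
  rw [h.measure_voidOne hV hB hVb hBb hd]
  have hk : (0 : ℝ) ≤ (k + 1 : ℕ) * δ := by positivity
  -- The void probability is bounded below by that of the whole outer disc, and the density of
  -- `nearestLaw` on `B` is bounded above by its value at the inner radius. The two differ by the
  -- area `δ`, which is the factor e^(-λδ) lost.
  have h1 : expNeg (ENNReal.ofReal (lam * ((k + 1 : ℕ) * δ))) ≤
      expNeg (ENNReal.ofReal lam * volume (V ∪ B)) := by
    refine antitone_expNeg ?_
    rw [ENNReal.ofReal_mul hl.le, ← volume_ball_discRadius y hk]
    gcongr
  have h2 : nearestLaw lam y B ≤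
      ENNReal.ofReal (lam * Real.exp (-(lam * (k * δ)))) * volume B := by
    unfold nearestLaw
    rw [withDensity_apply _ hB, ← setLIntegral_const]
    refine setLIntegral_mono measurable_const fun z hz => ?_
    have h3 := (hBA hz).2
    rw [Metric.mem_ball, not_lt, discRadius_le_iff dist_nonneg, dist_eq_norm] at h3
    apply ENNReal.ofReal_le_ofReal
    gcongr
  calc ENNReal.ofReal (Real.exp (-(lam * δ))) * nearestLaw lam y B
      ≤ ENNReal.ofReal (Real.exp (-(lam * δ))) *
        (ENNReal.ofReal (lam * Real.exp (-(lam * (k * δ)))) * volume B) := by gcongr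
    _ = expNeg (ENNReal.ofReal (lam * ((k + 1 : ℕ) * δ))) * (ENNReal.ofReal lam * volume B) := by
        have he : Real.exp (-(lam * ((k + 1 : ℕ) * δ))) =
            Real.exp (-(lam * δ)) * Real.exp (-(lam * (k * δ))) := by
          rw [← Real.exp_add]
          push_cast
          ring_nf
        rw [expNeg_ofReal (by positivity), he, ENNReal.ofReal_mul hl.le,
          ENNReal.ofReal_mul (Real.exp_pos _).le]
        ring
    _ ≤ _ := by gcongr

/-! ### Association on the void events -/

section Void

variable {x : ℕ → Plane} {a b : ℝ}

/-- If exactly one point lies in the disc of radius `b`, and none in that of radius `a`, then the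
origin is associated with that point. -/
lemma VoidOne.assoc_zero (h : VoidOne (Metric.ball 0 a) (Metric.ball 0 b \ Metric.ball 0 a) x) :
    a ≤ ‖x (assoc x 0)‖ ∧ ‖x (assoc x 0)‖ < b ∧ ∀ j, j ≠ assoc x 0 → b ≤ ‖x j‖ := by
  obtain ⟨h0, h1⟩ := h
  rw [pointCount_eq_zero] at h0
  rw [pointCount_eq_one] at h1
  obtain ⟨i, hi⟩ := h1
  have hii := (hi i).2 rfl
  have hother : ∀ j, j ≠ i → b ≤ ‖x j‖ := by
    intro j hj
    by_contra hlt
    exact hj ((hi j).1 ⟨by simpa using hlt, h0 j⟩)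
  have hib : ‖x i‖ < b := by simpa using hii.1
  have hia : a ≤ ‖x i‖ := by simpa using hii.2
  have hni : IsNearest x 0 i := by
    intro j
    simp only [dist_zero_left]
    rcases eq_or_ne j i with rfl | hj
    · exact le_rfl
    · exact hib.le.trans (hother j hj)
  have hn := isNearest_assoc ⟨i, hni⟩ i
  simp only [dist_zero_left] at hn
  have heq : assoc x 0 = i := by
    by_contra hne
    linarith [hother _ hne]
  rw [heq]
  exact ⟨hia, hib, hother⟩

/-- The void part of the event that the nearest point to `y` outside the disc of radius `b` lies
in the `k`-th annulus around `y` and outside the disc of radius `t`. -/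
def voidPart (y : Plane) (δ b t : ℝ) (k : ℕ) : Set Plane :=
  (Metric.ball y (discRadius (k * δ)) ∪ (annulus y δ k ∩ Metric.ball 0 t)) \ Metric.ball 0 b

/-- Apart from the station of the origin and the single point `j` of the annulus part, every point
is at least the outer radius away from `y`, while `j` is closer. The station of `y` is therefore one
of these two, and `hy` leaves only `j`. -/
lemma norm_assoc_ge_of_voidOne {t : ℝ} {y : Plane} {δ : ℝ} (hδ : 0 < δ) {k : ℕ}
    (h : VoidOne (Metric.ball 0 a) (Metric.ball 0 b \ Metric.ball 0 a) x)
    (hF : VoidOne (voidPart y δ b t k) (annulus y δ k \ Metric.ball 0 t) x)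
    (hy : assoc x y ≠ assoc x 0) : t ≤ ‖x (assoc x y)‖ := by
  obtain ⟨-, hb, hother⟩ := h.assoc_zero
  set i₀ := assoc x 0
  obtain ⟨hv, ho⟩ := hF
  rw [pointCount_eq_zero] at hv
  rw [pointCount_eq_one] at ho
  obtain ⟨j, hj⟩ := ho
  have hjj := (hj j).2 rfl
  have hjt : t ≤ ‖x j‖ := by simpa using hjj.2
  have hjs := hjj.1.1
  rw [Metric.mem_ball'] at hjs
  have hfar : ∀ m, m ≠ i₀ → m ≠ j → discRadius ((k + 1 : ℕ) * δ) ≤ dist y (x m) := by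
    intro m hm0 hmj
    by_contra hlt
    rw [not_le, ← Metric.mem_ball', ← ball_union_annulus y hδ k] at hlt
    have hmb : x m ∉ Metric.ball 0 b := by simpa using hother m hm0
    rcases hlt with hlt | hlt
    · exact hv m ⟨Or.inl hlt, hmb⟩
    · by_cases hmt : x m ∈ Metric.ball 0 t
      · exact hv m ⟨Or.inr ⟨hlt, hmt⟩, hmb⟩
      · exact hmj ((hj m).1 ⟨hlt, hmt⟩)
  -- `assoc` is meaningful only if a nearest point exists; here it is the closer of `i₀` and `j`.
  have hex : ∃ i, IsNearest x y i := by
    rcases le_total (dist y (x i₀)) (dist y (x j)) with hle | hle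
    · refine ⟨i₀, fun m => ?_⟩
      by_cases hm0 : m = i₀
      · rw [hm0]
      by_cases hmj : m = j
      · rwa [hmj]
      · exact hle.trans (hjs.le.trans (hfar m hm0 hmj))
    · refine ⟨j, fun m => ?_⟩
      by_cases hm0 : m = i₀
      · rwa [hm0]
      by_cases hmj : m = j
      · rw [hmj]
      · exact hjs.le.trans (hfar m hm0 hmj)
  have hn := isNearest_assoc hex j
  have : assoc x y = j := by
    by_contra hne
    linarith [hfar _ hy hne]
  rwa [this]

end Void

/-- The domination behind the downlink bound. On the conditioning event the only station in the disc
of radius `b` is the one serving the origin, and the process outside is an independent Poisson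
process. Removing the disc shrinks the region that must be empty for a given outer point to be
nearest to `y`, so it raises the probability that this nearest point lies beyond radius `t ≥ b`.
Passing to complements gives the upper bound. -/
lemma IsHomogeneousPPP.measure_norm_assoc_lt {Ω : Type*} [MeasurableSpace Ω] {P : Measure Ω}
    [IsProbabilityMeasure P] {X : ℕ → Ω → Plane} {lam : ℝ} (h : IsHomogeneousPPP P X lam)
    (hl : 0 < lam) {a b : ℝ} (hab : a ≤ b) (y : Plane) (t : ℝ) :
    P {ω | (VoidOne (Metric.ball 0 a) (Metric.ball 0 b \ Metric.ball 0 a) fun n => X n ω) ∧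
        assoc (fun n => X n ω) y ≠ assoc (fun n => X n ω) 0 ∧
        ‖X (assoc (fun n => X n ω) y) ω‖ < t} ≤
      P {ω | VoidOne (Metric.ball 0 a) (Metric.ball 0 b \ Metric.ball 0 a) fun n => X n ω} *
        nearestLaw lam y (Metric.ball 0 t) := by
  set G := {ω | VoidOne (Metric.ball 0 a) (Metric.ball 0 b \ Metric.ball 0 a) fun n => X n ω} with hG
  set H := {ω | (VoidOne (Metric.ball 0 a) (Metric.ball 0 b \ Metric.ball 0 a) fun n => X n ω) ∧
        assoc (fun n => X n ω) y ≠ assoc (fun n => X n ω) 0 ∧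
        ‖X (assoc (fun n => X n ω) y) ω‖ < t} with hH
  -- For `t < b` the event is empty, since all stations but that of the origin have norm at least
  -- `b`.
  rcases lt_or_ge t b with htb | hbt
  · have : H = ∅ := by
      refine Set.eq_empty_of_forall_notMem ?_
      rintro ω ⟨hω, hne, hlt⟩
      linarith [hω.assoc_zero.2.2 _ hne]
    rw [this, measure_empty]
    exact zero_le
  have hball : ∀ (z : Plane) (r : ℝ), MeasurableSet (Metric.ball z r) := fun z r =>
    Metric.isOpen_ball.measurableSet
  have hGm : MeasurableSet G :=
    h.measurable_pi (measurableSet_voidOne (hball _ _) ((hball _ _).diff (hball _ _)))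
  have hGf : P G ≠ ∞ := measure_ne_top _ _
  -- The complementary event is exhausted from inside by disjoint events `F k`, one for each annulus
  -- around `y`, at the cost of a factor e^(-λδ) that disappears as `δ → 0`.
  have key : ∀ δ : ℝ, 0 < δ → P H + P G *
      (ENNReal.ofReal (Real.exp (-(lam * δ))) * nearestLaw lam y (Metric.ball 0 t)ᶜ) ≤ P G := by
    intro δ hδ
    set B : ℕ → Set Plane := fun k => annulus y δ k \ Metric.ball 0 t with hB
    set F : ℕ → Set Ω := fun k => {ω | VoidOne (voidPart y δ b t k) (B k) fun n => X n ω} with hF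
    have hVm : ∀ k, MeasurableSet (voidPart y δ b t k) := fun k =>
      ((hball _ _).union ((measurableSet_annulus y δ k).inter (hball _ _))).diff (hball _ _)
    have hBm : ∀ k, MeasurableSet (B k) := fun k => (measurableSet_annulus y δ k).diff (hball _ _)
    have hFm : ∀ k, MeasurableSet (F k) := fun k =>
      h.measurable_pi (measurableSet_voidOne (hVm k) (hBm k))
    have hdVB : ∀ k, Disjoint (voidPart y δ b t k) (B k) := fun k => by
      refine Set.disjoint_left.2 ?_
      rintro z ⟨hz | hz, -⟩ hz'
      · exact hz'.1.2 hz
      · exact hz'.2 hz.2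
    have hVB : ∀ k, voidPart y δ b t k ∪ B k ⊆ Metric.ball y (discRadius ((k + 1 : ℕ) * δ)) := by
      intro k
      rw [← ball_union_annulus y hδ k]
      rintro z (⟨hz | hz, -⟩ | hz)
      · exact Or.inl hz
      · exact Or.inr hz.1
      · exact Or.inr hz.1
    have hdG : ∀ k, Disjoint (Metric.ball (0 : Plane) a ∪ (Metric.ball 0 b \ Metric.ball 0 a))
        (voidPart y δ b t k ∪ B k) := by
      intro k
      rw [Set.union_sdiff_cancel (Metric.ball_subset_ball hab)]
      refine Set.disjoint_left.2 ?_
      rintro z hz (hz' | hz')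
      · exact hz'.2 hz
      · exact hz'.2 (Metric.ball_subset_ball hbt hz)
    have hGF : ∀ k, P (G ∩ F k) = P G * P (F k) := fun k =>
      h.measure_voidOne_inter (hball _ _) ((hball _ _).diff (hball _ _)) (hVm k) (hBm k)
        Metric.isBounded_ball (Metric.isBounded_ball.subset Set.sdiff_subset)
        (Metric.isBounded_ball.subset (Set.subset_union_left.trans (hVB k)))
        (Metric.isBounded_ball.subset (Set.subset_union_right.trans (hVB k)))
        Set.disjoint_sdiff_right (hdVB k) (hdG k)
    -- The point found by `F k` lies in a region that `F l` requires to be empty.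
    have hFd : ∀ k l, k < l → Disjoint (F k) (F l) := by
      intro k l hkl
      refine Set.disjoint_left.2 fun ω hk hl' => ?_
      obtain ⟨j, hj⟩ := pointCount_eq_one.1 hk.2
      have hjj := (hj j).2 rfl
      exact pointCount_eq_zero.1 hl'.1 j ⟨Or.inl (ball_discRadius_mono y hδ hkl hjj.1.1),
        fun hb => hjj.2 (Metric.ball_subset_ball hbt hb)⟩
    have hFd' : Pairwise fun k l => Disjoint (G ∩ F k) (G ∩ F l) := by
      intro k l hkl
      rcases lt_or_gt_of_ne hkl with hlt | hlt
      · exact (hFd k l hlt).mono Set.inter_subset_right Set.inter_subset_right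
      · exact (hFd l k hlt).symm.mono Set.inter_subset_right Set.inter_subset_right
    have hHd : Disjoint H (⋃ k, G ∩ F k) := by
      refine Set.disjoint_left.2 fun ω hω hω' => ?_
      obtain ⟨k, hk⟩ := Set.mem_iUnion.1 hω'
      exact absurd (norm_assoc_ge_of_voidOne hδ hω.1 hk.2 hω.2.1) (not_le.2 hω.2.2)
    have hBU : ⋃ k, B k = (Metric.ball 0 t)ᶜ := by
      rw [hB, ← Set.iUnion_sdiff, iUnion_annulus y hδ, Set.compl_eq_univ_sdiff]
    have hBd : Pairwise fun k l => Disjoint (B k) (B l) := fun k l hkl =>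
      (pairwise_disjoint_annulus y hδ hkl).mono Set.sdiff_subset Set.sdiff_subset
    calc P H + P G * (ENNReal.ofReal (Real.exp (-(lam * δ))) * nearestLaw lam y (Metric.ball 0 t)ᶜ)
        = P H + ∑' k, P G * (ENNReal.ofReal (Real.exp (-(lam * δ))) * nearestLaw lam y (B k)) := by
          rw [← hBU, measure_iUnion hBd hBm, ENNReal.tsum_mul_left, ENNReal.tsum_mul_left]
      _ ≤ P H + ∑' k, P G * P (F k) := by
          gcongr with k
          exact h.nearestLaw_le_measure_voidOne hl y hδ k (hVm k) (hBm k) (hdVB k) (hVB k)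
            Set.sdiff_subset
      _ = P (H ∪ ⋃ k, G ∩ F k) := by
          rw [measure_union hHd (MeasurableSet.iUnion fun k => hGm.inter (hFm k)),
            measure_iUnion hFd' fun k => hGm.inter (hFm k)]
          simp only [hGF]
      _ ≤ P G := measure_mono (Set.union_subset (fun ω hω => hω.1)
          (Set.iUnion_subset fun k => Set.inter_subset_left))
  -- Total mass 1 turns the lower bound for the complement into the upper bound sought.
  have hsplit : nearestLaw lam y (Metric.ball 0 t) + nearestLaw lam y (Metric.ball 0 t)ᶜ = 1 := by
    rw [measure_add_measure_compl (hball _ _), nearestLaw_univ hl]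
  have hcf : nearestLaw lam y (Metric.ball 0 t)ᶜ ≠ ∞ :=
    (measure_mono (Set.subset_univ _)).trans_lt ((nearestLaw_univ hl y).trans_lt
      ENNReal.one_lt_top) |>.ne
  have hlim : P H + P G * nearestLaw lam y (Metric.ball 0 t)ᶜ ≤ P G := by
    have ht : Tendsto (fun δ : ℝ => P H + P G *
        (ENNReal.ofReal (Real.exp (-(lam * δ))) * nearestLaw lam y (Metric.ball 0 t)ᶜ)) (𝓝[>] 0)
        (𝓝 (P H + P G * (1 * nearestLaw lam y (Metric.ball 0 t)ᶜ))) := by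
      refine Tendsto.const_add _ (ENNReal.Tendsto.const_mul (ENNReal.Tendsto.mul_const ?_
        (Or.inr hcf)) (Or.inr hGf))
      have hc : Continuous fun δ : ℝ => ENNReal.ofReal (Real.exp (-(lam * δ))) :=
        ENNReal.continuous_ofReal.comp (by fun_prop)
      simpa using (hc.tendsto 0).mono_left nhdsWithin_le_nhds
    rw [one_mul] at ht
    exact le_of_tendsto ht (eventually_mem_nhdsWithin.mono fun δ hδ => key δ hδ)
  have h3 : P G = P G * nearestLaw lam y (Metric.ball 0 t) +
      P G * nearestLaw lam y (Metric.ball 0 t)ᶜ := by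
    rw [← mul_add, hsplit, mul_one]
  conv_rhs at hlim => rw [h3]
  exact (ENNReal.add_le_add_iff_right (ENNReal.mul_ne_top hGf hcf)).1 hlim

/-! ### The mean interference functional -/

/-- The decreasing function `d ↦ 1 / (1 + d ^ α / m)`. -/
def softStep (α m d : ℝ) : ℝ := 1 / (1 + d ^ α / m)

lemma measurable_softStep (α m : ℝ) : Measurable (softStep α m) := by
  unfold softStep
  fun_prop

lemma softStep_nonneg {α m d : ℝ} (hm : 0 < m) (hd : 0 ≤ d) : 0 ≤ softStep α m d := by
  unfold softStep
  positivity

/-- Monotonicity makes superlevel sets into discs, so a layer-cake integral needs only the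
domination on discs. For `c ≥ 1` the disc is empty and `τ = 0` serves. -/
lemma exists_lt_softStep_iff {α m c : ℝ} (hα : 0 < α) (hm : 0 < m) (hc : 0 < c) :
    ∃ τ : ℝ, ∀ d, 0 ≤ d → (c < softStep α m d ↔ d < τ) := by
  have h1 : ∀ d, 0 ≤ d → (c < softStep α m d ↔ d ^ α < m * (1 / c - 1)) := by
    intro d hd
    unfold softStep
    have : 0 < 1 + d ^ α / m := by positivity
    rw [lt_div_iff₀ this, ← div_lt_iff₀' hm, lt_sub_iff_add_lt, lt_div_iff₀ hc]
    constructor <;> intro h <;> linarith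
  rcases lt_or_ge c 1 with hc1 | hc1
  · have h2 : 0 < 1 / c - 1 := by
      rw [sub_pos, lt_div_iff₀ hc]; linarith
    refine ⟨(m * (1 / c - 1)) ^ (1 / α), fun d hd => ?_⟩
    rw [h1 d hd, one_div α, Real.lt_rpow_inv_iff_of_pos hd (by positivity) hα]
  · have h2 : 1 / c - 1 ≤ 0 := by
      rw [sub_nonpos, div_le_iff₀ hc]; linarith
    refine ⟨0, fun d hd => ?_⟩
    rw [h1 d hd]
    have h3 : m * (1 / c - 1) ≤ 0 := mul_nonpos_of_nonneg_of_nonpos hm.le h2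
    have h4 : 0 ≤ d ^ α := by positivity
    constructor <;> intro h <;> linarith

lemma integrableOn_one_div_one_add_rpow {a : ℝ} (ha : 1 < a) :
    IntegrableOn (fun u : ℝ => 1 / (1 + u ^ a)) (Set.Ioi 0) := by
  have hmeas : AEStronglyMeasurable (fun u : ℝ => 1 / (1 + u ^ a)) volume := by
    have : Measurable fun u : ℝ => 1 / (1 + u ^ a) := by fun_prop
    exact this.aestronglyMeasurable
  rw [← Set.Ioc_union_Ioi_eq_Ioi (zero_le_one' ℝ)]
  refine IntegrableOn.union ?_ ?_
  · refine Measure.integrableOn_of_bounded (M := 1) (by simp) hmeas ?_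
    filter_upwards [ae_restrict_mem measurableSet_Ioc] with u hu
    have : 0 ≤ u ^ a := Real.rpow_nonneg hu.1.le _
    rw [Real.norm_of_nonneg (by positivity), div_le_one (by positivity)]
    linarith
  · refine Integrable.mono' (integrableOn_Ioi_rpow_of_lt (a := -a) (by linarith) one_pos)
      hmeas.restrict ?_
    filter_upwards [ae_restrict_mem measurableSet_Ioi] with u hu
    have hu0 : (0 : ℝ) < u := lt_trans one_pos hu
    have : 0 < u ^ a := Real.rpow_pos_of_pos hu0 _
    rw [Real.norm_of_nonneg (by positivity), Real.rpow_neg hu0.le, ← one_div]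
    gcongr
    linarith

lemma rho_pos {α : ℝ} (hα : 2 < α) : 0 < rho α := by
  unfold rho
  rw [setIntegral_pos_iff_support_of_nonneg_ae]
  · have : Set.Ioi (0 : ℝ) ⊆ Function.support fun u : ℝ => 1 / (1 + u ^ (α / 2)) := by
      intro u hu
      have : 0 < u ^ (α / 2) := Real.rpow_pos_of_pos hu _
      exact ne_of_gt (by positivity)
    rw [Set.inter_eq_right.2 this]
    simp
  · filter_upwards [ae_restrict_mem measurableSet_Ioi] with u hu
    have : 0 < u ^ (α / 2) := Real.rpow_pos_of_pos hu _
    simp only [Pi.zero_apply]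
    positivity
  · exact integrableOn_one_div_one_add_rpow (by linarith)

/-- Polar coordinates and the substitution u = r² / m^(2/α); this is where the constant `rho`
arises. -/
lemma lintegral_softStep_norm {α m : ℝ} (hα : 2 < α) (hm : 0 < m) :
    ∫⁻ z : Plane, ENNReal.ofReal (softStep α m ‖z‖) =
      ENNReal.ofReal (Real.pi * m ^ (2 / α) * rho α) := by
  have hα0 : 0 < α := by linarith
  set s := m ^ (2 / α) with hs
  have hs0 : 0 < s := Real.rpow_pos_of_pos hm _
  have h1 : ∫ z : Plane, softStep α m ‖z‖ = Real.pi * s * rho α := by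
    rw [integral_fun_norm_addHaar volume (softStep α m)]
    have h2 := integral_comp_rpow_Ioi_of_pos (g := fun u : ℝ => 1 / (1 + (s⁻¹ * u) ^ (α / 2)))
      (two_pos : (0 : ℝ) < 2)
    have h3 := integral_comp_mul_left_Ioi (fun u : ℝ => 1 / (1 + u ^ (α / 2))) 0 (inv_pos.2 hs0)
    rw [h3] at h2
    have h4 : volume.real (Metric.ball (0 : Plane) 1) = Real.pi := by
      rw [measureReal_def, EuclideanSpace.volume_ball_fin_two]
      simp [Real.pi_pos.le]
    have h5 : ∀ x ∈ Set.Ioi (0 : ℝ), (2 * x ^ ((2 : ℝ) - 1)) •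
        (1 / (1 + (s⁻¹ * x ^ (2 : ℝ)) ^ (α / 2))) = 2 * (x * softStep α m x) := by
      intro x hx
      have hx0 : 0 < x := hx
      have e1 : (x ^ (2 : ℝ)) ^ (α / 2) = x ^ α := by
        rw [← Real.rpow_mul hx0.le]; congr 1; ring
      have e2 : s ^ (α / 2) = m := by
        rw [hs, ← Real.rpow_mul hm.le]
        have : 2 / α * (α / 2) = 1 := by field_simp
        rw [this, Real.rpow_one]
      have e3 : (2 : ℝ) - 1 = 1 := by norm_num
      rw [Real.mul_rpow (by positivity) (by positivity), e1, Real.inv_rpow hs0.le, e2, e3,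
        Real.rpow_one, smul_eq_mul, softStep]
      ring
    rw [setIntegral_congr_fun measurableSet_Ioi h5, integral_const_mul] at h2
    simp only [finrank_euclideanSpace, Fintype.card_fin, h4, smul_eq_mul, nsmul_eq_mul, mul_zero,
      inv_inv] at h2 ⊢
    simp only [Nat.cast_ofNat, show 2 - 1 = 1 from rfl, pow_one]
    rw [show rho α = ∫ u in Set.Ioi (0 : ℝ), 1 / (1 + u ^ (α / 2)) from rfl]
    linear_combination Real.pi * h2
  -- A nonzero Bochner integral forces integrability.
  have hint : Integrable fun z : Plane => softStep α m ‖z‖ := by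
    refine Integrable.of_integral_ne_zero ?_
    rw [h1]
    have := rho_pos hα
    have := Real.pi_pos
    positivity
  rw [← ofReal_integral_eq_lintegral_ofReal hint
    (Eventually.of_forall fun z => softStep_nonneg hm (norm_nonneg z)), h1]

/-- The density depends only on |z - y|, hence has total mass 1 in `y` as well as in `z`: a mass
transport principle. -/
lemma lintegral_nearestLaw {lam : ℝ} (hl : 0 < lam) {f : Plane → ℝ≥0∞} (hf : Measurable f) :
    ∫⁻ y, ∫⁻ z, f z ∂(nearestLaw lam y) = ∫⁻ z, f z := by
  have hk : Measurable fun p : Plane × Plane =>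
      ENNReal.ofReal (lam * Real.exp (-(lam * (Real.pi * ‖p.2 - p.1‖ ^ 2)))) := by fun_prop
  have h1 : ∀ y, ∫⁻ z, f z ∂(nearestLaw lam y) = ∫⁻ z,
      ENNReal.ofReal (lam * Real.exp (-(lam * (Real.pi * ‖z - y‖ ^ 2)))) * f z := fun y =>
    lintegral_withDensity_eq_lintegral_mul _ (by fun_prop) hf
  simp only [h1]
  rw [lintegral_lintegral_swap (by
    exact (hk.mul (hf.comp measurable_snd)).aemeasurable)]
  refine lintegral_congr fun z => ?_
  rw [lintegral_mul_const _ (by fun_prop)]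
  have h2 : ∫⁻ y : Plane, ENNReal.ofReal (lam * Real.exp (-(lam * (Real.pi * ‖z - y‖ ^ 2)))) = 1 := by
    rw [← lintegral_gaussian hl]
    exact lintegral_sub_left_eq_self (μ := (volume : Measure Plane))
      (fun z => ENNReal.ofReal (lam * Real.exp (-(lam * (Real.pi * ‖z‖ ^ 2))))) z
  rw [h2, one_mul]

open Classical in
/-- The interference functional `1[x_{assoc y} ≠ x_{assoc 0}] * softStep ‖x_{assoc y}‖`. -/
def otherCell (f : ℝ → ℝ) (x : ℕ → Plane) (y : Plane) : ℝ :=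
  if assoc x y ≠ assoc x 0 then f ‖x (assoc x y)‖ else 0

lemma measurableSet_assoc_ne :
    MeasurableSet {p : (ℕ → Plane) × Plane | assoc p.1 p.2 ≠ assoc p.1 0} :=
  (measurableSet_eq_fun measurable_assoc
    (measurable_assoc_comp measurable_fst measurable_const)).compl

lemma measurable_norm_assoc :
    Measurable fun p : (ℕ → Plane) × Plane => ‖p.1 (assoc p.1 p.2)‖ :=
  (measurable_apply_nat measurable_fst measurable_assoc).norm

lemma measurable_otherCell {f : ℝ → ℝ} (hf : Measurable f) :
    Measurable fun p : (ℕ → Plane) × Plane => otherCell f p.1 p.2 := by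
  classical
  exact Measurable.ite measurableSet_assoc_ne (hf.comp measurable_norm_assoc) measurable_const

attribute [local irreducible] assoc

/-- For each `y`, layer-cake and the domination on discs replace the station of `y` by a point with
law `nearestLaw lam y`. Integrating over `y` then leaves a Lebesgue integral, in which the intensity
no longer appears. -/
lemma IsHomogeneousPPP.setLIntegral_otherCell_le {Ω : Type*} [MeasurableSpace Ω] {P : Measure Ω}
    [IsProbabilityMeasure P] {X : ℕ → Ω → Plane} {lam : ℝ} (h : IsHomogeneousPPP P X lam)
    (hl : 0 < lam) {a b : ℝ} (hab : a ≤ b) {α m : ℝ} (hα : 2 < α) (hm : 0 < m) :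
    ∫⁻ ω in {ω | VoidOne (Metric.ball 0 a) (Metric.ball 0 b \ Metric.ball 0 a) fun n => X n ω},
      (∫⁻ y, ENNReal.ofReal (otherCell (softStep α m) (fun n => X n ω) y)) ∂P ≤
    P {ω | VoidOne (Metric.ball 0 a) (Metric.ball 0 b \ Metric.ball 0 a) fun n => X n ω} *
      ENNReal.ofReal (Real.pi * m ^ (2 / α) * rho α) := by
  set G := {ω | VoidOne (Metric.ball 0 a) (Metric.ball 0 b \ Metric.ball 0 a) fun n => X n ω} with hG
  have hms : Measurable fun z : Plane => softStep α m ‖z‖ := (measurable_softStep α m).comp measurable_norm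
  have hmo : Measurable fun p : Ω × Plane => otherCell (softStep α m) (fun n => X n p.1) p.2 := by
    have h1 : Measurable fun p : Ω × Plane => ((fun n => X n p.1), p.2) :=
      (h.measurable_pi.comp measurable_fst).prodMk measurable_snd
    have h2 := (measurable_otherCell (measurable_softStep α m)).comp h1
    simp only [Function.comp_def] at h2
    exact h2
  have hball : ∀ (z : Plane) (r : ℝ), MeasurableSet (Metric.ball z r) := fun z r =>
    Metric.isOpen_ball.measurableSet
  have hGm : MeasurableSet G :=
    h.measurable_pi (measurableSet_voidOne (hball _ _) ((hball _ _).diff (hball _ _)))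
  have key : ∀ y, ∫⁻ ω in G, ENNReal.ofReal (otherCell (softStep α m) (fun n => X n ω) y) ∂P ≤
      P G * ∫⁻ z, ENNReal.ofReal (softStep α m ‖z‖) ∂(nearestLaw lam y) := by
    intro y
    have hmy : Measurable fun ω => otherCell (softStep α m) (fun n => X n ω) y :=
      hmo.comp measurable_prodMk_right
    rw [lintegral_eq_lintegral_meas_lt (P.restrict G) (Eventually.of_forall fun ω => by
        unfold otherCell
        split_ifs
        · exact softStep_nonneg hm (norm_nonneg _)
        · exact le_rfl) hmy.aemeasurable,
      lintegral_eq_lintegral_meas_lt (nearestLaw lam y)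
        (Eventually.of_forall fun z => softStep_nonneg hm (norm_nonneg z)) hms.aemeasurable,
      ← lintegral_const_mul' _ _ (measure_ne_top P G)]
    refine setLIntegral_mono' measurableSet_Ioi fun c hc => ?_
    obtain ⟨τ, hτ⟩ := exists_lt_softStep_iff (α := α) (by linarith) hm hc
    rw [Measure.restrict_apply (measurableSet_lt measurable_const hmy)]
    have e1 : {z : Plane | c < softStep α m ‖z‖} = Metric.ball 0 τ := by
      ext z
      simp [hτ _ (norm_nonneg z)]
    rw [e1]
    refine (measure_mono ?_).trans (h.measure_norm_assoc_lt hl hab y τ)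
    rintro ω ⟨hω, hωG⟩
    have hω' : c < otherCell (softStep α m) (fun n => X n ω) y := hω
    unfold otherCell at hω'
    split_ifs at hω' with hne
    · exact ⟨hωG, hne, (hτ _ (norm_nonneg _)).1 hω'⟩
    · exact absurd hω' (not_lt.2 (le_of_lt hc))
  rw [lintegral_lintegral_swap hmo.ennreal_ofReal.aemeasurable]
  refine (lintegral_mono key).trans ?_
  rw [lintegral_const_mul' _ _ (measure_ne_top P G), lintegral_nearestLaw hl hms.ennreal_ofReal,
    lintegral_softStep_norm hα hm]

/-! ### Coverage on a shell -/

/-- Coverage probability on the event `X ∈ G`: the fading is averaged out first, then the users,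
then the base stations. -/
lemma mul_expNeg_le_measure_coverage {Ω ι : Type*} [MeasurableSpace Ω] [Countable ι] {P : Measure Ω}
    [IsProbabilityMeasure P] {X U : ℕ → Ω → Plane} {g : ι → Ω → ℝ} {lamU : ℝ}
    (hX : ∀ n, Measurable (X n)) (hU : IsHomogeneousPPP P U lamU)
    (hXU : IndepFun (fun ω n => X n ω) (fun ω n => U n ω) P) (hg : IsRayleighFading P g X U)
    {G : Set (ℕ → Plane)} (hG : MeasurableSet G) {i₀ : (ℕ → Plane) → ι}
    (hi₀ : Measurable fun p : (ℕ → Plane) × (ι → ℝ) => p.2 (i₀ p.1))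
    {c : ι → (ℕ → Plane) × (ℕ → Plane) → ℝ≥0∞} (hc : ∀ i, Measurable (c i))
    (hc₀ : ∀ x u, c (i₀ x) (x, u) = 0) (κ : ℝ≥0∞)
    {ψ : (ℕ → Plane) × Plane → ℝ≥0∞} (hψ : Measurable ψ)
    (hcψ : ∀ x u, ∑' i, logOnePlus (c i (x, u)) ≤ ∑' j, ψ (x, u j))
    {I : ℝ≥0∞} (hI : ∫⁻ ω in {ω | (fun n => X n ω) ∈ G},
      (∫⁻ y, (1 - expNeg (ψ (fun n => X n ω, y)))) ∂P ≤ P {ω | (fun n => X n ω) ∈ G} * I) :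
    P {ω | (fun n => X n ω) ∈ G} * expNeg (κ + ENNReal.ofReal lamU * I) ≤
      P {ω | (fun n => X n ω) ∈ G ∧
        κ + ∑' i, c i (fun n => X n ω, fun n => U n ω) * ENNReal.ofReal (g i ω) <
          ENNReal.ofReal (g (i₀ fun n => X n ω) ω)} := by
  have hXm : Measurable fun ω n => X n ω := measurable_pi_lambda _ hX
  have hUm : Measurable fun ω n => U n ω := hU.measurable_pi
  have hgm : Measurable fun ω i => g i ω := measurable_pi_lambda _ hg.measurable
  set GΩ := {ω | (fun n => X n ω) ∈ G} with hGΩ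
  have hGm : MeasurableSet GΩ := hXm hG
  -- the success event on the product of the fading and location spaces
  set T : Set (((ℕ → Plane) × (ℕ → Plane)) × (ι → ℝ)) := {p | p.1.1 ∈ G ∧
    κ + ∑' i, c i p.1 * ENNReal.ofReal (p.2 i) < ENNReal.ofReal (p.2 (i₀ p.1.1))} with hT
  have hTm : MeasurableSet T := by
    have h1 : MeasurableSet {p : ((ℕ → Plane) × (ℕ → Plane)) × (ι → ℝ) | p.1.1 ∈ G} :=
      measurable_fst.fst hG
    have h2 : MeasurableSet {p : ((ℕ → Plane) × (ℕ → Plane)) × (ι → ℝ) |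
        κ + ∑' i, c i p.1 * ENNReal.ofReal (p.2 i) < ENNReal.ofReal (p.2 (i₀ p.1.1))} := by
      refine measurableSet_lt ?_ ?_
      · exact (Measurable.tsum fun i => ((hc i).comp measurable_fst).mul
          ((measurable_pi_apply i).comp measurable_snd).ennreal_ofReal).const_add κ
      · exact (hi₀.comp (measurable_fst.fst.prodMk measurable_snd)).ennreal_ofReal
    exact h1.inter h2
  have hm2 : Measurable fun p : (ℕ → Plane) × (ℕ → Plane) =>
      G.indicator (fun _ => expNeg (κ + ∑' j, ψ (p.1, p.2 j))) p.1 := by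
    have h1 : Measurable fun p : (ℕ → Plane) × (ℕ → Plane) => expNeg (κ + ∑' j, ψ (p.1, p.2 j)) :=
      ((Measurable.tsum fun j => hψ.comp (measurable_fst.prodMk
        ((measurable_pi_apply j).comp measurable_snd))).const_add κ).expNeg
    exact h1.indicator (measurable_fst hG)
  have hA : Measurable fun ω => ∫⁻ y, (1 - expNeg (ψ (fun n => X n ω, y))) := by
    have h1 : Measurable fun p : (ℕ → Plane) × Plane => 1 - expNeg (ψ p) := hψ.expNeg.const_sub 1
    exact h1.lintegral_prod_right'.comp hXm
  have hind := hg.indep_locations.symm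
  calc P GΩ * expNeg (κ + ENNReal.ofReal lamU * I)
      = expNeg κ * (P GΩ * expNeg (ENNReal.ofReal lamU * I)) := by rw [expNeg_add]; ring
    _ ≤ expNeg κ * ∫⁻ ω in GΩ,
        expNeg (ENNReal.ofReal lamU * ∫⁻ y, (1 - expNeg (ψ (fun n => X n ω, y)))) ∂P := by
        gcongr
        -- Jensen over the stations: only the mean load on `G` is controlled, by `hI`.
        refine mul_expNeg_le_setLIntegral (measure_ne_top _ _) (hA.const_mul _) ?_
        rw [lintegral_const_mul _ hA]
        calc _ ≤ ENNReal.ofReal lamU * (P GΩ * I) := by gcongr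
          _ = _ := by ring
    _ ≤ expNeg κ * ∫⁻ ω in GΩ, (∫⁻ ω', expNeg (∑' j, ψ (fun n => X n ω, U j ω')) ∂P) ∂P := by
        gcongr with ω
        -- The stations are frozen while an independent copy of the users is averaged.
        exact hU.expNeg_le_lintegral_expNeg_tsum (hψ.comp measurable_prodMk_left)
    _ = ∫⁻ ω, ∫⁻ ω', G.indicator (fun _ => expNeg (κ + ∑' j, ψ (fun n => X n ω, U j ω')))
          (fun n => X n ω) ∂P ∂P := by
        rw [← lintegral_indicator hGm, ← lintegral_const_mul' _ _
          ((expNeg_le_one κ).trans_lt ENNReal.one_lt_top).ne]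
        refine lintegral_congr fun ω => ?_
        by_cases hω : (fun n => X n ω) ∈ G
        · have hω' : ω ∈ GΩ := hω
          simp only [Set.indicator_of_mem hω, Set.indicator_of_mem hω', expNeg_add]
          rw [lintegral_const_mul' _ _ ((expNeg_le_one κ).trans_lt ENNReal.one_lt_top).ne]
        · have hω' : ω ∉ GΩ := hω
          simp [Set.indicator_of_notMem hω, Set.indicator_of_notMem hω']
    _ = ∫⁻ ω, G.indicator (fun _ => expNeg (κ + ∑' j, ψ (fun n => X n ω, U j ω)))
          (fun n => X n ω) ∂P := (lintegral_indepFun_eq hXm hUm hXU hm2).symm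
    _ ≤ ∫⁻ ω, ∫⁻ ω', T.indicator 1
          ((((fun n => X n ω), (fun n => U n ω)), fun i => g i ω')) ∂P ∂P := by
        refine lintegral_mono fun ω => ?_
        by_cases hω : (fun n => X n ω) ∈ G
        · rw [Set.indicator_of_mem hω]
          calc expNeg (κ + ∑' j, ψ (fun n => X n ω, U j ω))
              ≤ expNeg (κ + ∑' i, logOnePlus (c i (fun n => X n ω, fun n => U n ω))) := by
                refine antitone_expNeg ?_
                gcongr
                exact hcψ _ _
            _ = P {ω' | κ + ∑' i, c i (fun n => X n ω, fun n => U n ω) * ENNReal.ofReal (g i ω') <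
                  ENNReal.ofReal (g (i₀ fun n => X n ω) ω')} :=
                (measure_signal_gt hg.measurable hg.law hg.indep _ κ _ (hc₀ _ _)).symm
            _ = _ := by
                have hms : MeasurableSet {ω' | κ + ∑' i, c i (fun n => X n ω, fun n => U n ω) *
                    ENNReal.ofReal (g i ω') < ENNReal.ofReal (g (i₀ fun n => X n ω) ω')} :=
                  measurableSet_lt ((Measurable.tsum fun i =>
                    (hg.measurable i).ennreal_ofReal.const_mul _).const_add κ)
                    (hg.measurable _).ennreal_ofReal
                rw [← lintegral_indicator_one hms]
                refine lintegral_congr fun ω' => ?_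
                by_cases hω' : κ + ∑' i, c i (fun n => X n ω, fun n => U n ω) *
                    ENNReal.ofReal (g i ω') < ENNReal.ofReal (g (i₀ fun n => X n ω) ω')
                · rw [Set.indicator_of_mem (by exact hω'), Set.indicator_of_mem (by exact ⟨hω, hω'⟩)]
                  rfl
                · rw [Set.indicator_of_notMem (by exact hω'),
                    Set.indicator_of_notMem (by exact fun h => hω' h.2)]
        · rw [Set.indicator_of_notMem hω]
          exact zero_le
    _ = ∫⁻ ω, T.indicator 1 ((((fun n => X n ω), (fun n => U n ω)), fun i => g i ω)) ∂P :=
        (lintegral_indepFun_eq (hXm.prodMk hUm) hgm hind (measurable_one.indicator hTm)).symm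
    _ = P {ω | (fun n => X n ω) ∈ G ∧
        κ + ∑' i, c i (fun n => X n ω, fun n => U n ω) * ENNReal.ofReal (g i ω) <
          ENNReal.ofReal (g (i₀ fun n => X n ω) ω)} := by
        have hms : MeasurableSet {ω | (((fun n => X n ω), (fun n => U n ω)), fun i => g i ω) ∈ T} :=
          ((hXm.prodMk hUm).prodMk hgm) hTm
        exact lintegral_indicator_one hms

/-- The left side is c/(1 + c), increasing in c, so `r` may be replaced by the outer radius `b`. -/
lemma one_sub_expNeg_logOnePlus_le {α t r b d : ℝ} (ht : 0 < t) (hα : 0 < α) (hr : 0 ≤ r)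
    (hb : 0 < b) (hrb : r ≤ b) (hd : 0 ≤ d) :
    1 - expNeg (logOnePlus (ENNReal.ofReal (t * r ^ α * d ^ (-α)))) ≤
      ENNReal.ofReal (softStep α (t * b ^ α) d) := by
  rw [expNeg_logOnePlus]
  rcases hd.eq_or_lt with rfl | hd
  · rw [Real.zero_rpow (by linarith)]
    simp
  have hc : 0 ≤ t * r ^ α * d ^ (-α) := by positivity
  rw [← ENNReal.ofReal_one, ← ENNReal.ofReal_add zero_le_one hc,
    ← ENNReal.ofReal_inv_of_pos (by positivity), ← ENNReal.ofReal_sub _ (by positivity)]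
  apply ENNReal.ofReal_le_ofReal
  have hm : t * r ^ α * d ^ (-α) ≤ t * b ^ α * d ^ (-α) := by gcongr
  have h1 : 1 - (1 + t * r ^ α * d ^ (-α))⁻¹ ≤ 1 - (1 + t * b ^ α * d ^ (-α))⁻¹ := by gcongr
  refine h1.trans (le_of_eq ?_)
  unfold softStep
  have hdp : 0 < d ^ α := Real.rpow_pos_of_pos hd _
  have hbp : 0 < b ^ α := Real.rpow_pos_of_pos hb _
  rw [Real.rpow_neg hd.le]
  field_simp
  ring

/-- The multiplied-out form suits the coverage lemma and also covers `J = 0`; `J = ∞` is excluded by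
the hypothesis `h`. -/
lemma lt_rxPower_div {α g r t : ℝ} {J : ℝ≥0∞} (hr : 0 < r) (ht : 0 < t)
    (h : ENNReal.ofReal (t * r ^ α) * J < ENNReal.ofReal g) :
    ENNReal.ofReal t < rxPower α g r / J := by
  have hrp : 0 < r ^ α := Real.rpow_pos_of_pos hr _
  rw [ENNReal.lt_div_iff_mul_lt (Or.inr ENNReal.ofReal_ne_top) (Or.inr (by simpa using ht)),
    rxPower, ENNReal.ofReal_mul' (by positivity), Real.rpow_neg hr.le,
    ENNReal.ofReal_inv_of_pos hrp, ← div_eq_mul_inv,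
    ENNReal.lt_div_iff_mul_lt (Or.inl (by simpa using hrp)) (Or.inl ENNReal.ofReal_ne_top)]
  refine lt_of_eq_of_lt ?_ h
  rw [ENNReal.ofReal_mul ht.le]
  ring

/-- The configurations with no point in the disc of area `k * δ` and exactly one in the
surrounding annulus of area `δ`. -/
def shell (δ : ℝ) (k : ℕ) : Set (ℕ → Plane) :=
  {x | VoidOne (Metric.ball 0 (discRadius (k * δ))) (annulus 0 δ k) x}

lemma measurableSet_shell (δ : ℝ) (k : ℕ) : MeasurableSet (shell δ k) :=
  measurableSet_voidOne Metric.isOpen_ball.measurableSet (measurableSet_annulus _ _ _)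

lemma norm_assoc_of_mem_shell {δ : ℝ} {k : ℕ} {x : ℕ → Plane} (h : x ∈ shell δ k) :
    discRadius (k * δ) ≤ ‖x (assoc x 0)‖ ∧ ‖x (assoc x 0)‖ < discRadius ((k + 1 : ℕ) * δ) :=
  ⟨(VoidOne.assoc_zero h).1, (VoidOne.assoc_zero h).2.1⟩

lemma disjoint_shell {δ : ℝ} (hδ : 0 < δ) {k l : ℕ} (hkl : k ≠ l) :
    Disjoint (shell δ k) (shell δ l) := by
  have key : ∀ k x, x ∈ shell δ k → x (assoc x 0) ∈ annulus 0 δ k := by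
    intro k x hx
    have := norm_assoc_of_mem_shell hx
    exact ⟨by simpa using this.2, by simpa using this.1⟩
  exact Set.disjoint_left.2 fun x hk hl =>
    Set.disjoint_left.1 (pairwise_disjoint_annulus 0 hδ hkl) (key k x hk) (key l x hl)

lemma volume_annulus (y : Plane) {δ : ℝ} (hδ : 0 < δ) (k : ℕ) :
    volume (annulus y δ k) = ENNReal.ofReal δ := by
  unfold annulus
  rw [measure_sdiff (ball_discRadius_mono y hδ k.le_succ)
    Metric.isOpen_ball.measurableSet.nullMeasurableSet Metric.isBounded_ball.measure_lt_top.ne,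
    volume_ball_discRadius y (by positivity), volume_ball_discRadius y (by positivity),
    ← ENNReal.ofReal_sub _ (by positivity)]
  congr 1
  push_cast
  ring

lemma IsHomogeneousPPP.measure_shell {Ω : Type*} [MeasurableSpace Ω] {P : Measure Ω}
    {X : ℕ → Ω → Plane} {lam : ℝ} (h : IsHomogeneousPPP P X lam) (hl : 0 < lam) {δ : ℝ}
    (hδ : 0 < δ) (k : ℕ) :
    P {ω | (fun n => X n ω) ∈ shell δ k} =
      expNeg (ENNReal.ofReal (lam * ((k + 1 : ℕ) * δ))) * ENNReal.ofReal (lam * δ) := by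
  have h1 := h.measure_voidOne (V := Metric.ball 0 (discRadius (k * δ))) (B := annulus 0 δ k)
    Metric.isOpen_ball.measurableSet (measurableSet_annulus _ _ _) Metric.isBounded_ball
    (Metric.isBounded_ball.subset Set.sdiff_subset) Set.disjoint_sdiff_right
  rw [ball_union_annulus 0 hδ, volume_ball_discRadius 0 (by positivity), volume_annulus 0 hδ,
    ← ENNReal.ofReal_mul hl.le, ← ENNReal.ofReal_mul hl.le] at h1
  exact h1

/-- The contribution of the `k`-th shell to the coverage probability at threshold `t`. -/
def shellTerm (α lamB lamU noise t δ : ℝ) (k : ℕ) : ℝ :=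
  lamB * δ * Real.exp (-((lamB + lamU * (rho α * t ^ (2 / α))) * ((k + 1 : ℕ) * δ) +
    t * discRadius ((k + 1 : ℕ) * δ) ^ α * noise))

/-- The power `2 / α` turns b^α into b², so the load is linear in the disc area `v` and the sum over
shells is geometric apart from noise. -/
lemma rpow_mul_discRadius {α t v : ℝ} (hα : 2 < α) (ht : 0 < t) (hv : 0 < v) :
    Real.pi * (t * discRadius v ^ α) ^ (2 / α) * rho α = rho α * t ^ (2 / α) * v := by
  have hb := discRadius_pos hv
  rw [Real.mul_rpow ht.le (by positivity), ← Real.rpow_mul hb.le,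
    mul_div_cancel₀ _ (by linarith : α ≠ 0), Real.rpow_two]
  linear_combination (t ^ (2 / α) * rho α) * discRadius_sq hv.le

lemma shellTerm_eq {Ω : Type*} [MeasurableSpace Ω] {P : Measure Ω}
    {X : ℕ → Ω → Plane} {α lamB lamU noise t δ : ℝ} (h : IsHomogeneousPPP P X lamB) (hα : 2 < α)
    (hB : 0 < lamB) (hU : 0 < lamU) (hn : 0 ≤ noise) (ht : 0 < t) (hδ : 0 < δ) (k : ℕ) :
    ENNReal.ofReal (shellTerm α lamB lamU noise t δ k) = P {ω | (fun n => X n ω) ∈ shell δ k} *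
      expNeg (ENNReal.ofReal (t * discRadius ((k + 1 : ℕ) * δ) ^ α * noise) + ENNReal.ofReal lamU *
        ENNReal.ofReal (Real.pi * (t * discRadius ((k + 1 : ℕ) * δ) ^ α) ^ (2 / α) * rho α)) := by
  have hv : (0 : ℝ) < (k + 1 : ℕ) * δ := by positivity
  have hb := discRadius_pos hv
  have hr := rho_pos hα
  rw [h.measure_shell hB hδ, rpow_mul_discRadius hα ht hv, ← ENNReal.ofReal_mul hU.le,
    ← ENNReal.ofReal_add (by positivity) (by positivity), expNeg_ofReal (by positivity),
    expNeg_ofReal (by positivity), ← ENNReal.ofReal_mul (by positivity),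
    ← ENNReal.ofReal_mul (by positivity)]
  congr 1
  rw [mul_comm (Real.exp (-(lamB * ((k + 1 : ℕ) * δ)))), mul_assoc, ← Real.exp_add, shellTerm]
  congr 2
  ring

/-! ### Downlink and uplink coverage on one shell -/

section Coverage

variable {Ω : Type*} [MeasurableSpace Ω] {P : Measure Ω} [IsProbabilityMeasure P]
  {X U : ℕ → Ω → Plane} {α lamB lamU noise t δ : ℝ}

open Classical in
/-- The interference weights in the downlink. -/
def downlinkWeight (α t : ℝ) (i : ℕ) (p : (ℕ → Plane) × (ℕ → Plane)) : ℝ≥0∞ :=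
  if i ≠ assoc p.1 0 ∧ IsActive p.1 p.2 i then
    ENNReal.ofReal (t * ‖p.1 (assoc p.1 0)‖ ^ α * ‖p.1 i‖ ^ (-α)) else 0

open Classical in
/-- The contribution of a user at `p.2` to the downlink interference, assuming that its own base
station transmits for it alone. -/
def downlinkLoad (α t : ℝ) (p : (ℕ → Plane) × Plane) : ℝ≥0∞ :=
  if assoc p.1 p.2 ≠ assoc p.1 0 then logOnePlus (ENNReal.ofReal
    (t * ‖p.1 (assoc p.1 0)‖ ^ α * ‖p.1 (assoc p.1 p.2)‖ ^ (-α))) else 0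

lemma measurable_norm_assoc_zero {E : Type*} [MeasurableSpace E] {f : E → ℕ → Plane}
    (hf : Measurable f) : Measurable fun p => ‖f p (assoc (f p) 0)‖ :=
  (measurable_apply_nat hf (measurable_assoc_comp hf measurable_const)).norm

lemma measurable_downlinkWeight (α t : ℝ) (i : ℕ) : Measurable (downlinkWeight α t i) := by
  classical
  have h1 : Measurable fun p : (ℕ → Plane) × (ℕ → Plane) => assoc p.1 0 :=
    measurable_assoc_comp measurable_fst measurable_const
  have h2 : ∀ j : ℕ, Measurable fun p : (ℕ → Plane) × (ℕ → Plane) => assoc p.1 (p.2 j) := fun j =>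
    measurable_assoc_comp measurable_fst ((measurable_pi_apply j).comp measurable_snd)
  have h3 : MeasurableSet {p : (ℕ → Plane) × (ℕ → Plane) | i ≠ assoc p.1 0} :=
    (measurableSet_eq_fun measurable_const h1).compl
  have h4 : MeasurableSet {p : (ℕ → Plane) × (ℕ → Plane) | IsActive p.1 p.2 i} := by
    unfold IsActive
    rw [Set.ofPred_exists]
    exact MeasurableSet.iUnion fun j => measurableSet_eq_fun (h2 j) measurable_const
  have h5 : Measurable fun p : (ℕ → Plane) × (ℕ → Plane) => ‖p.1 (assoc p.1 0)‖ :=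
    measurable_norm_assoc_zero measurable_fst
  have h6 : Measurable fun p : (ℕ → Plane) × (ℕ → Plane) => ‖p.1 i‖ :=
    ((measurable_pi_apply i).comp measurable_fst).norm
  unfold downlinkWeight
  exact Measurable.ite (h3.inter h4)
    (((h5.pow_const α).const_mul t).mul (h6.pow_const (-α))).ennreal_ofReal measurable_const

lemma measurable_downlinkLoad (α t : ℝ) : Measurable (downlinkLoad α t) := by
  classical
  have h5 : Measurable fun p : (ℕ → Plane) × Plane => ‖p.1 (assoc p.1 0)‖ :=
    measurable_norm_assoc_zero measurable_fst
  unfold downlinkLoad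
  exact Measurable.ite measurableSet_assoc_ne
    (((h5.pow_const α).const_mul t).mul
      (measurable_norm_assoc.pow_const (-α))).ennreal_ofReal.logOnePlus measurable_const

/-- An active station interferes once and has at least one user to whom this can be charged;
counting it once for each of its users only increases the sum. -/
lemma tsum_downlinkWeight_le (α t : ℝ) (x u : ℕ → Plane) :
    ∑' i, logOnePlus (downlinkWeight α t i (x, u)) ≤ ∑' j, downlinkLoad α t (x, u j) := by
  classical
  -- Sort the users by their station, so that after exchanging sums the comparison is made station
  -- by station.
  have h1 : ∀ j, downlinkLoad α t (x, u j) =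
      ∑' i, if i = assoc x (u j) then downlinkLoad α t (x, u j) else 0 := fun j => by
    rw [tsum_ite_eq]
  rw [tsum_congr h1, ENNReal.tsum_comm]
  refine ENNReal.tsum_le_tsum fun i => ?_
  unfold downlinkWeight
  split_ifs with h
  · obtain ⟨hi, j, hj⟩ := h
    refine le_trans (le_of_eq ?_) (ENNReal.le_tsum j)
    have hj' : assoc x (u j) ≠ assoc x 0 := by rwa [hj]
    simp only [downlinkLoad, hj, hi, ne_eq, not_false_eq_true, if_true]
  · simp

lemma downlink_shell {g : ℕ → Ω → ℝ} (hX : IsHomogeneousPPP P X lamB)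
    (hU : IsHomogeneousPPP P U lamU)
    (hXU : IndepFun (fun ω n => X n ω) (fun ω n => U n ω) P) (hg : IsRayleighFading P g X U)
    (hα : 2 < α) (hB : 0 < lamB) (hlU : 0 < lamU) (hn : 0 ≤ noise) (ht : 0 < t) (hδ : 0 < δ)
    {k : ℕ} (hk : 1 ≤ k) :
    ENNReal.ofReal (shellTerm α lamB lamU noise t δ k) ≤
      P {ω | (fun n => X n ω) ∈ shell δ k ∧ ENNReal.ofReal t <
        downlinkSINR α noise (fun n => X n ω) (fun n => U n ω) (fun i => g i ω)} := by
  classical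
  have hv : (0 : ℝ) < (k + 1 : ℕ) * δ := by positivity
  have hb := discRadius_pos hv
  rw [shellTerm_eq hX hα hB hlU hn ht hδ k]
  refine (mul_expNeg_le_measure_coverage hX.measurable hU hXU hg (measurableSet_shell δ k)
    (i₀ := fun x => assoc x 0) (c := downlinkWeight α t) (ψ := downlinkLoad α t)
    (measurable_apply_nat measurable_snd (measurable_assoc_comp measurable_fst measurable_const))
    (measurable_downlinkWeight α t) (fun x u => by simp [downlinkWeight]) _
    (measurable_downlinkLoad α t) (tsum_downlinkWeight_le α t) ?_).trans (measure_mono ?_)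
  -- Mean load, with `softStep` taken at the outer radius of the shell.
  · refine le_trans ?_ (hX.setLIntegral_otherCell_le hB
      (discRadius_mono (by gcongr; exact k.le_succ) :
        discRadius (k * δ) ≤ discRadius ((k + 1 : ℕ) * δ)) hα
      (by positivity : 0 < t * discRadius ((k + 1 : ℕ) * δ) ^ α))
    refine setLIntegral_mono' (hX.measurable_pi (measurableSet_shell δ k)) fun ω hω => ?_
    refine lintegral_mono fun y => ?_
    unfold downlinkLoad otherCell
    split_ifs with hne
    · exact one_sub_expNeg_logOnePlus_le ht (by linarith) (norm_nonneg _) hb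
        (norm_assoc_of_mem_shell hω).2.le (norm_nonneg _)
    · simp
  · rintro ω ⟨hω, hlt⟩
    refine ⟨hω, ?_⟩
    obtain ⟨h1, h2⟩ := norm_assoc_of_mem_shell hω
    -- Here `1 ≤ k` matters: the shell stays away from the origin, where the path loss would
    -- degenerate.
    have hr : 0 < ‖X (assoc (fun n => X n ω) 0) ω‖ :=
      (discRadius_pos (by positivity)).trans_le h1
    refine lt_rxPower_div hr ht (lt_of_le_of_lt ?_ hlt)
    rw [mul_add, add_comm, ← ENNReal.tsum_mul_left]
    refine add_le_add ?_ (ENNReal.tsum_le_tsum fun i => ?_)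
    · rw [← ENNReal.ofReal_mul (by positivity)]
      exact ENNReal.ofReal_le_ofReal (by gcongr)
    · unfold downlinkWeight
      split_ifs with hi
      · rw [rxPower, mul_comm (g i ω), ← ENNReal.ofReal_mul (by positivity),
          ← ENNReal.ofReal_mul (by positivity), mul_assoc _ _ (g i ω)]
      · simp

/-- The interference weights in the uplink when all users transmit. -/
def uplinkWeight (α t : ℝ) : Option ℕ → (ℕ → Plane) × (ℕ → Plane) → ℝ≥0∞
  | none, _ => 0
  | some j, p => ENNReal.ofReal
    (t * ‖p.1 (assoc p.1 0)‖ ^ α * dist (p.2 j) (p.1 (assoc p.1 0)) ^ (-α))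

/-- The contribution of a user at `p.2` to the uplink interference. -/
def uplinkLoad (α t : ℝ) (p : (ℕ → Plane) × Plane) : ℝ≥0∞ := logOnePlus (ENNReal.ofReal
    (t * ‖p.1 (assoc p.1 0)‖ ^ α * dist p.2 (p.1 (assoc p.1 0)) ^ (-α)))

lemma measurable_uplinkLoad (α t : ℝ) : Measurable (uplinkLoad α t) := by
  have h4 : Measurable fun p : (ℕ → Plane) × Plane => p.1 (assoc p.1 0) :=
    measurable_apply_nat measurable_fst (measurable_assoc_comp measurable_fst measurable_const)
  unfold uplinkLoad
  exact (((h4.norm.pow_const α).const_mul t).mul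
    ((measurable_snd.dist h4).pow_const (-α))).ennreal_ofReal.logOnePlus

lemma measurable_uplinkWeight (α t : ℝ) (i : Option ℕ) : Measurable (uplinkWeight α t i) := by
  rcases i with - | j
  · exact measurable_const
  have h4 : Measurable fun p : (ℕ → Plane) × (ℕ → Plane) => p.1 (assoc p.1 0) :=
    measurable_apply_nat measurable_fst (measurable_assoc_comp measurable_fst measurable_const)
  have h5 : Measurable fun p : (ℕ → Plane) × (ℕ → Plane) => p.2 j :=
    (measurable_pi_apply j).comp measurable_snd
  exact (((h4.norm.pow_const α).const_mul t).mul
    ((h5.dist h4).pow_const (-α))).ennreal_ofReal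

lemma tsum_option_eq (f : Option ℕ → ℝ≥0∞) (h : f none = 0) :
    ∑' i, f i = ∑' j, f (some j) := by
  refine ((Option.some_injective ℕ).tsum_eq fun i hi => ?_).symm
  rcases i with - | j
  · exact absurd h hi
  · exact ⟨j, rfl⟩

/-- Letting every user transmit only lowers the SINR, so any `S` is allowed. The load of a location
depends only on its displacement from the serving station, so for every station configuration in the
shell its integral is bounded by the same translation-invariant quantity. -/
lemma uplink_shell {h : Option ℕ → Ω → ℝ} (hX : IsHomogeneousPPP P X lamB)
    (hU : IsHomogeneousPPP P U lamU)
    (hXU : IndepFun (fun ω n => X n ω) (fun ω n => U n ω) P) (hg : IsRayleighFading P h X U)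
    (hα : 2 < α) (hB : 0 < lamB) (hlU : 0 < lamU) (hn : 0 ≤ noise) (ht : 0 < t) (hδ : 0 < δ)
    {k : ℕ} (hk : 1 ≤ k) (S : Ω → Set ℕ) :
    ENNReal.ofReal (shellTerm α lamB lamU noise t δ k) ≤
      P {ω | (fun n => X n ω) ∈ shell δ k ∧ ENNReal.ofReal t <
        uplinkSINR α noise (fun n => X n ω) (fun n => U n ω) (fun i => h i ω) (S ω)} := by
  classical
  have hv : (0 : ℝ) < (k + 1 : ℕ) * δ := by positivity
  have hb := discRadius_pos hv
  rw [shellTerm_eq hX hα hB hlU hn ht hδ k]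
  refine (mul_expNeg_le_measure_coverage hX.measurable hU hXU hg (measurableSet_shell δ k)
    (i₀ := fun _ => none) (c := uplinkWeight α t) (ψ := uplinkLoad α t)
    ((measurable_pi_apply _).comp measurable_snd)
    (measurable_uplinkWeight α t) (fun x u => rfl) _
    (measurable_uplinkLoad α t) (fun x u => le_of_eq (tsum_option_eq _ (by simp [uplinkWeight])))
    ?_).trans (measure_mono ?_)
  · rw [mul_comm, ← setLIntegral_const]
    refine setLIntegral_mono' (hX.measurable_pi (measurableSet_shell δ k)) fun ω hω => ?_
    -- Recentre the plane at the serving station.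
    rw [← lintegral_softStep_norm hα (by positivity), ← lintegral_sub_right_eq_self
      (μ := (volume : Measure Plane)) (fun y => ENNReal.ofReal
        (softStep α (t * discRadius ((k + 1 : ℕ) * δ) ^ α) ‖y‖)) (X (assoc (fun n => X n ω) 0) ω)]
    refine lintegral_mono fun y => ?_
    unfold uplinkLoad
    rw [← dist_eq_norm]
    exact one_sub_expNeg_logOnePlus_le ht (by linarith) (norm_nonneg _) hb
        (norm_assoc_of_mem_shell hω).2.le dist_nonneg
  · rintro ω ⟨hω, hlt⟩
    refine ⟨hω, ?_⟩
    obtain ⟨h1, h2⟩ := norm_assoc_of_mem_shell hω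
    have hr : 0 < ‖X (assoc (fun n => X n ω) 0) ω‖ :=
      (discRadius_pos (by positivity)).trans_le h1
    refine lt_rxPower_div hr ht (lt_of_le_of_lt ?_ hlt)
    rw [mul_add, add_comm, ← ENNReal.tsum_mul_left, tsum_option_eq _ (by simp [uplinkWeight])]
    refine add_le_add ?_ (ENNReal.tsum_le_tsum fun j => ?_)
    · rw [← ENNReal.ofReal_mul (by positivity)]
      exact ENNReal.ofReal_le_ofReal (by gcongr)
    · split_ifs with hi
      · rw [rxPower, uplinkWeight, mul_comm (h (some j) ω), ← ENNReal.ofReal_mul (by positivity),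
          ← ENNReal.ofReal_mul (by positivity), mul_assoc _ _ (h (some j) ω)]
      · simp

end Coverage

/-- Summing a lower bound over the shells. -/
lemma sum_le_measure_of_shell {Ω : Type*} [MeasurableSpace Ω] {P : Measure Ω}
    {X : ℕ → Ω → Plane} {δ : ℝ} (hX : ∀ n, Measurable (X n)) (hδ : 0 < δ) (s : Finset ℕ)
    {A : Set Ω} (hA : MeasurableSet A) {f : ℕ → ℝ≥0∞}
    (hf : ∀ k ∈ s, f k ≤ P {ω | (fun n => X n ω) ∈ shell δ k ∧ ω ∈ A}) :
    ∑ k ∈ s, f k ≤ P A := by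
  have hXm : Measurable fun ω n => X n ω := measurable_pi_lambda _ hX
  refine (Finset.sum_le_sum hf).trans ?_
  rw [← measure_biUnion_finset]
  · exact measure_mono (Set.iUnion₂_subset fun k _ ω hω => hω.2)
  · intro k _ l _ hkl
    exact Set.disjoint_left.2 fun ω hω hω' =>
      Set.disjoint_left.1 (disjoint_shell hδ hkl) hω.1 hω'.1
  · intro k _
    exact (hXm (measurableSet_shell δ k)).inter hA

/-! ### From coverage probabilities to spectral efficiency -/

/-- Tonelli applied to log(1 + z) = ∫₀^z dt/(1 + t). -/
lemma lintegral_measure_le_spectralEfficiency {Ω : Type*} [MeasurableSpace Ω] {P : Measure Ω}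
    [IsProbabilityMeasure P] {Z : Ω → ℝ≥0∞} (hZ : Measurable Z) :
    ∫⁻ t in Set.Ioi (0 : ℝ), ENNReal.ofReal (1 / (1 + t)) * P {ω | ENNReal.ofReal t < Z ω} ≤
      spectralEfficiency P Z := by
  have hset : MeasurableSet {p : Ω × ℝ | ENNReal.ofReal p.2 < Z p.1} :=
    measurableSet_lt (ENNReal.measurable_ofReal.comp measurable_snd) (hZ.comp measurable_fst)
  have hm : Measurable fun p : Ω × ℝ => {p : Ω × ℝ | ENNReal.ofReal p.2 < Z p.1}.indicator
      (fun p => ENNReal.ofReal (1 / (1 + p.2))) p :=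
    Measurable.indicator (by fun_prop) hset
  calc _ = ∫⁻ t in Set.Ioi (0 : ℝ), ∫⁻ ω, {p : Ω × ℝ | ENNReal.ofReal p.2 < Z p.1}.indicator
          (fun p => ENNReal.ofReal (1 / (1 + p.2))) (ω, t) ∂P := by
        refine lintegral_congr fun t => ?_
        rw [← lintegral_indicator_const (measurableSet_lt measurable_const hZ)]
        rfl
    _ = ∫⁻ ω, (∫⁻ t in Set.Ioi (0 : ℝ), {p : Ω × ℝ | ENNReal.ofReal p.2 < Z p.1}.indicator
          (fun p => ENNReal.ofReal (1 / (1 + p.2))) (ω, t)) ∂P :=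
        (lintegral_lintegral_swap hm.aemeasurable).symm
    _ ≤ _ := lintegral_mono fun ω => lintegral_indicator_le_logOnePlus (Z ω)

lemma measurable_rxPower {E : Type*} [MeasurableSpace E] (α : ℝ) {g d : E → ℝ} (hg : Measurable g)
    (hd : Measurable d) : Measurable fun e => rxPower α (g e) (d e) :=
  (hg.mul (hd.pow_const _)).ennreal_ofReal

section Measurability

variable {Ω : Type*} [MeasurableSpace Ω] {X U : ℕ → Ω → Plane}

lemma measurable_downlinkSINR (hX : ∀ n, Measurable (X n)) (hU : ∀ n, Measurable (U n))
    {g : ℕ → Ω → ℝ} (hg : ∀ n, Measurable (g n)) (α noise : ℝ) :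
    Measurable fun ω => downlinkSINR α noise (fun n => X n ω) (fun n => U n ω) (fun i => g i ω) := by
  classical
  have hXm : Measurable fun ω n => X n ω := measurable_pi_lambda _ hX
  have hgm : Measurable fun ω n => g n ω := measurable_pi_lambda _ hg
  have h0 : Measurable fun ω => assoc (fun n => X n ω) 0 := measurable_assoc_comp hXm measurable_const
  have h1 : Measurable fun ω => g (assoc (fun n => X n ω) 0) ω := measurable_apply_nat hgm h0
  have h2 : Measurable fun ω => X (assoc (fun n => X n ω) 0) ω := measurable_apply_nat hXm h0
  unfold downlinkSINR
  refine (measurable_rxPower α h1 h2.norm).div (Measurable.add_const (Measurable.tsum fun i => ?_) _)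
  have h3 : MeasurableSet {ω | i ≠ assoc (fun n => X n ω) 0} :=
    (measurableSet_eq_fun measurable_const h0).compl
  have h4 : MeasurableSet {ω | IsActive (fun n => X n ω) (fun n => U n ω) i} := by
    unfold IsActive
    rw [Set.ofPred_exists]
    exact MeasurableSet.iUnion fun j =>
      measurableSet_eq_fun (measurable_assoc_comp hXm (hU j)) measurable_const
  exact Measurable.ite (h3.inter h4) (measurable_rxPower α (hg i) (hX i).norm) measurable_const

lemma measurable_uplinkSINR (hX : ∀ n, Measurable (X n)) (hU : ∀ n, Measurable (U n))
    {h : Option ℕ → Ω → ℝ} (hh : ∀ i, Measurable (h i)) {S : Ω → Set ℕ}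
    (hS : ∀ j, MeasurableSet {ω | j ∈ S ω}) (α noise : ℝ) :
    Measurable fun ω =>
      uplinkSINR α noise (fun n => X n ω) (fun n => U n ω) (fun i => h i ω) (S ω) := by
  classical
  have hXm : Measurable fun ω n => X n ω := measurable_pi_lambda _ hX
  have h0 : Measurable fun ω => assoc (fun n => X n ω) 0 := measurable_assoc_comp hXm measurable_const
  have h1 : Measurable fun ω => X (assoc (fun n => X n ω) 0) ω := measurable_apply_nat hXm h0
  unfold uplinkSINR
  refine (measurable_rxPower α (hh none) h1.norm).div
    (Measurable.add_const (Measurable.tsum fun j => ?_) _)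
  exact Measurable.ite (hS j) (measurable_rxPower α (hh (some j)) ((hU j).dist h1)) measurable_const

end Measurability

/-! ### The integral of the coverage bound -/

/-- A lower bound for the sum of the first shells, with vanishing mesh `1 / (n + 1)`. -/
def shellBound (lamB c t : ℝ) (n : ℕ) : ℝ :=
  Real.exp (-(t / (n + 1))) * (lamB / c) *
    (Real.exp (-(c * (2 / (n + 1)))) - Real.exp (-(c * (n + 1 + 2 / (n + 1)))))

/-- A noise level that is negligible on the first shells of mesh `1 / (n + 1)`. -/
def noiseLevel (α : ℝ) (n : ℕ) : ℝ :=
  1 / ((n + 1) * discRadius (((n + 1) ^ 2 + 1 : ℕ) * (1 / (n + 1))) ^ α)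

lemma noiseLevel_pos (α : ℝ) (n : ℕ) : 0 < noiseLevel α n := by
  have := discRadius_pos (v := ((n + 1) ^ 2 + 1 : ℕ) * (1 / ((n : ℝ) + 1))) (by positivity)
  unfold noiseLevel
  positivity

/-- A left-endpoint Riemann sum of the decreasing function e^(-cv) over [2δ, (K+2)δ] dominates the
integral. The shell `k = 0` is skipped, hence the start at 2δ. -/
lemma sum_exp_ge {c δ : ℝ} (hc : 0 < c) (K : ℕ) :
    1 / c * (Real.exp (-(c * (2 * δ))) - Real.exp (-(c * ((K + 2 : ℕ) * δ)))) ≤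
      ∑ k ∈ Finset.Icc 1 K, δ * Real.exp (-(c * ((k + 1 : ℕ) * δ))) := by
  induction K with
  | zero => simp
  | succ K ih =>
    rw [Finset.sum_Icc_succ_top (by omega)]
    refine le_trans ?_ (add_le_add_left ih _)
    have h1 : Real.exp (-(c * ((K + 1 + 2 : ℕ) * δ))) =
        Real.exp (-(c * ((K + 2 : ℕ) * δ))) * Real.exp (-(c * δ)) := by
      rw [← Real.exp_add]
      push_cast
      ring_nf
    have h2 := Real.add_one_le_exp (-(c * δ))
    have h3 := Real.exp_pos (-(c * ((K + 2 : ℕ) * δ)))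
    rw [h1, show K + 1 + 1 = K + 2 from rfl]
    set E := Real.exp (-(c * ((K + 2 : ℕ) * δ)))
    set F := Real.exp (-(c * δ))
    have h4 : 1 / c * (E * (1 - F)) ≤ δ * E := by
      rw [one_div, inv_mul_le_iff₀ hc]
      nlinarith
    have h5 : ∀ A : ℝ, 1 / c * (A - E * F) = 1 / c * (A - E) + 1 / c * (E * (1 - F)) := fun A => by ring
    rw [h5]
    linarith

/-- With mesh 1/(n+1), the first (n+1)² shells reach out to area about n+1, so they fill the plane
as the mesh vanishes. On them the noise costs at most the factor e^(-t/(n+1)). -/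
lemma shellBound_le_sum {α lamB lamU noise t : ℝ} (hα : 2 < α) (hB : 0 < lamB) (hU : 0 < lamU)
    (ht : 0 < t) {n : ℕ} (hn : noise ≤ noiseLevel α n) :
    shellBound lamB (lamB + lamU * (rho α * t ^ (2 / α))) t n ≤
      ∑ k ∈ Finset.Icc 1 ((n + 1) ^ 2), shellTerm α lamB lamU noise t (1 / (n + 1)) k := by
  have hr := rho_pos hα
  set δ : ℝ := 1 / (n + 1) with hδ
  have hδ0 : 0 < δ := by positivity
  set c := lamB + lamU * (rho α * t ^ (2 / α)) with hcdef
  have hc : 0 < c := by positivity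
  have h1 : ∀ k ∈ Finset.Icc 1 ((n + 1) ^ 2), Real.exp (-(t / (n + 1))) * lamB *
      (δ * Real.exp (-(c * ((k + 1 : ℕ) * δ)))) ≤ shellTerm α lamB lamU noise t δ k := by
    intro k hk
    have hk2 := (Finset.mem_Icc.1 hk).2
    unfold shellTerm
    have hle : discRadius ((k + 1 : ℕ) * δ) ^ α ≤ discRadius (((n + 1) ^ 2 + 1 : ℕ) * δ) ^ α := by
      refine Real.rpow_le_rpow (discRadius_pos (by positivity)).le (discRadius_mono ?_) (by linarith)
      gcongr
    have hk0 := discRadius_pos (v := (k + 1 : ℕ) * δ) (by positivity)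
    have hM := discRadius_pos (v := ((n + 1) ^ 2 + 1 : ℕ) * δ) (by positivity)
    have h2 : t * discRadius ((k + 1 : ℕ) * δ) ^ α * noise ≤ t / (n + 1) := by
      calc _ ≤ t * discRadius ((k + 1 : ℕ) * δ) ^ α * noiseLevel α n := by gcongr
        _ ≤ t * discRadius (((n + 1) ^ 2 + 1 : ℕ) * δ) ^ α * noiseLevel α n := by
          have := noiseLevel_pos α n
          gcongr
        _ = t / (n + 1) := by
          unfold noiseLevel
          rw [← hδ]
          have : discRadius (((n + 1) ^ 2 + 1 : ℕ) * δ) ^ α ≠ 0 := (Real.rpow_pos_of_pos hM _).ne'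
          field_simp
    rw [neg_add, Real.exp_add]
    calc _ = lamB * δ * (Real.exp (-(c * ((k + 1 : ℕ) * δ))) * Real.exp (-(t / (n + 1)))) := by ring
      _ ≤ _ := by gcongr
  refine le_trans ?_ (Finset.sum_le_sum h1)
  rw [← Finset.mul_sum]
  have h3 := sum_exp_ge (δ := δ) hc ((n + 1) ^ 2)
  refine le_trans (le_of_eq ?_) (mul_le_mul_of_nonneg_left h3 (by positivity))
  unfold shellBound
  have e1 : 2 / ((n : ℝ) + 1) = 2 * δ := by rw [hδ]; ring
  have e2 : (n : ℝ) + 1 + 2 * δ = (((n + 1) ^ 2 + 2 : ℕ) : ℝ) * δ := by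
    rw [hδ]; push_cast; field_simp
  rw [e1, e2]
  ring

lemma tendsto_shellBound {lamB c t : ℝ} (hc : 0 < c) :
    Tendsto (shellBound lamB c t) atTop (𝓝 (lamB / c)) := by
  have hn : Tendsto (fun n : ℕ => (n : ℝ) + 1) atTop atTop :=
    tendsto_atTop_add_const_right _ _ tendsto_natCast_atTop_atTop
  have h1 : ∀ s : ℝ, Tendsto (fun n : ℕ => s / ((n : ℝ) + 1)) atTop (𝓝 0) := fun s =>
    tendsto_const_nhds.div_atTop hn
  have h2 : Tendsto (fun n : ℕ => Real.exp (-(t / ((n : ℝ) + 1)))) atTop (𝓝 1) := by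
    have := (Real.continuous_exp.tendsto _).comp (h1 t).neg
    simpa [Function.comp_def] using this
  have h3 : Tendsto (fun n : ℕ => Real.exp (-(c * (2 / ((n : ℝ) + 1))))) atTop (𝓝 1) := by
    have := (Real.continuous_exp.tendsto _).comp ((h1 2).const_mul c).neg
    simpa [Function.comp_def] using this
  have h4 : Tendsto (fun n : ℕ => Real.exp (-(c * ((n : ℝ) + 1 + 2 / ((n : ℝ) + 1))))) atTop (𝓝 0) :=
    Real.tendsto_exp_neg_atTop_nhds_zero.comp ((hn.atTop_add (h1 2)).const_mul_atTop hc)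
  have h5 := (h2.mul_const (lamB / c)).mul (h3.sub h4)
  rw [one_mul, sub_zero, mul_one] at h5
  exact h5

/-- Strict Jensen inequality for the log-logistic distribution with median `m`: its tail
`1 / (1 + (t / m) ^ β)` integrates against `1 / (1 + t)` to more than `log (1 + m)`. -/
lemma log_one_add_lt_lintegral {m β : ℝ} (hm : 0 < m) :
    ENNReal.ofReal (Real.log (1 + m)) <
      ∫⁻ t in Set.Ioi (0 : ℝ), ENNReal.ofReal (1 / (1 + (t / m) ^ β) * (1 / (1 + t))) := by
  set f : ℝ → ℝ := fun t => 1 / (1 + (t / m) ^ β) * (1 / (1 + t)) with hf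
  have hfm : Measurable fun t => ENNReal.ofReal (f t) := by
    rw [hf]; fun_prop
  -- The inversion about `m` folds (m, ∞) onto (0, m) and sends (t/m)^β to its inverse, so the tail
  -- weights 1/(1+w) and w/(1+w) at paired points add up to 1.
  have himg : (fun s : ℝ => m ^ 2 / s) '' Set.Ioo 0 m = Set.Ioi m := by
    ext t
    constructor
    · rintro ⟨s, hs, rfl⟩
      rw [Set.mem_Ioi, lt_div_iff₀ hs.1]
      nlinarith [hs.2]
    · intro ht
      have ht0 : 0 < t := hm.trans ht
      refine ⟨m ^ 2 / t, ⟨by positivity, ?_⟩, by field_simp⟩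
      rw [div_lt_iff₀ ht0]
      nlinarith [Set.mem_Ioi.1 ht]
  have hcv : ∫⁻ t in Set.Ioi m, ENNReal.ofReal (f t) =
      ∫⁻ s in Set.Ioo 0 m, ENNReal.ofReal |-(m ^ 2) / s ^ 2| * ENNReal.ofReal (f (m ^ 2 / s)) := by
    rw [← himg]
    refine lintegral_image_eq_lintegral_abs_deriv_mul measurableSet_Ioo (fun s hs => ?_) ?_ _
    · have := (hasDerivAt_inv hs.1.ne').const_mul (m ^ 2)
      have h2 : HasDerivAt (fun s : ℝ => m ^ 2 / s) (-(m ^ 2) / s ^ 2) s := by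
        rw [show -(m ^ 2) / s ^ 2 = m ^ 2 * -(s ^ 2)⁻¹ by ring]
        exact this
      exact h2.hasDerivWithinAt
    · intro s hs s' hs' h
      have h1 := hs.1
      have h2 := hs'.1
      simp only at h
      field_simp at h
      exact h.symm
  have hsplit : ∫⁻ t in Set.Ioi (0 : ℝ), ENNReal.ofReal (f t) = ∫⁻ s in Set.Ioo 0 m,
      (ENNReal.ofReal (f s) + ENNReal.ofReal |-(m ^ 2) / s ^ 2| * ENNReal.ofReal (f (m ^ 2 / s))) := by
    rw [← Set.Ioc_union_Ioi_eq_Ioi hm.le, lintegral_union measurableSet_Ioi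
      (Set.Ioc_disjoint_Ioi le_rfl), hcv, ← restrict_Ioo_eq_restrict_Ioc, lintegral_add_left hfm]
  rw [hsplit, ← lintegral_Ioc_one_div_one_add hm.le, ← restrict_Ioo_eq_restrict_Ioc]
  refine setLIntegral_strict_mono measurableSet_Ioo (by simp [hm]) ?_ ?_ ?_
  · exact (hfm.add (by rw [hf]; fun_prop))
  · rw [restrict_Ioo_eq_restrict_Ioc, lintegral_Ioc_one_div_one_add hm.le]
    exact ENNReal.ofReal_ne_top
  · refine Eventually.of_forall fun s hs => ?_
    have hs0 := hs.1
    set w := (s / m) ^ β with hw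
    have hw0 : 0 < w := Real.rpow_pos_of_pos (by positivity) _
    have hinv : (m ^ 2 / s / m) ^ β = w⁻¹ := by
      rw [hw, ← Real.inv_rpow (by positivity)]
      congr 1
      field_simp
    have hf2 : f (m ^ 2 / s) = 1 / (1 + w⁻¹) * (1 / (1 + m ^ 2 / s)) := by
      simp only [hf, hinv]
    have hfs : f s = 1 / (1 + w) * (1 / (1 + s)) := by simp only [hf, hw]
    rw [← ENNReal.ofReal_mul (abs_nonneg _), ← ENNReal.ofReal_add (by rw [hfs]; positivity)
      (mul_nonneg (abs_nonneg _) (by rw [hf2]; positivity)),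
      ENNReal.ofReal_lt_ofReal_iff_of_nonneg (by positivity), hf2, hfs, neg_div, abs_neg,
      abs_of_pos (by positivity)]
    have e1 : m ^ 2 / s ^ 2 * (1 / (1 + w⁻¹) * (1 / (1 + m ^ 2 / s))) =
        w / (1 + w) * (m ^ 2 / (s * (s + m ^ 2))) := by
      field_simp
      ring
    -- The inverted density exceeds 1/(1+s) exactly because s² < m² on (0, m); this makes the
    -- inequality strict.
    have e2 : 1 / (1 + s) < m ^ 2 / (s * (s + m ^ 2)) := by
      rw [div_lt_div_iff₀ (by positivity) (by positivity)]
      nlinarith [hs.2]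
    have e3 : 1 / (1 + s) = 1 / (1 + w) * (1 / (1 + s)) + w / (1 + w) * (1 / (1 + s)) := by
      rw [← add_mul, ← add_div, div_self (by positivity), one_mul]
    rw [e1]
    have : 0 < w / (1 + w) := by positivity
    have := mul_lt_mul_of_pos_left e2 this
    linarith

/-- For some mesh, the lower bound obtained from finitely many shells exceeds `seBound`. -/
lemma exists_seBound_lt {α lamB lamU : ℝ} (hα : 2 < α) (hB : 0 < lamB) (hU : 0 < lamU) :
    ∃ n : ℕ, ENNReal.ofReal (seBound α lamB lamU) < ∫⁻ t in Set.Ioi (0 : ℝ),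
      ENNReal.ofReal (1 / (1 + t)) *
        ENNReal.ofReal (shellBound lamB (lamB + lamU * (rho α * t ^ (2 / α))) t n) := by
  have hr := rho_pos hα
  set m := (lamB / (rho α * lamU)) ^ (α / 2) with hm
  have hm0 : 0 < m := by positivity
  have h1 := log_one_add_lt_lintegral (β := 2 / α) hm0
  -- The mesh limit is the log-logistic tail, since m^(2/α) = λ_B / (ρ λ_U). It is written as a
  -- `liminf` for Fatou's lemma.
  have h2 : ∀ t ∈ Set.Ioi (0 : ℝ), ENNReal.ofReal (1 / (1 + (t / m) ^ (2 / α)) * (1 / (1 + t))) =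
      liminf (fun n => ENNReal.ofReal (1 / (1 + t)) *
        ENNReal.ofReal (shellBound lamB (lamB + lamU * (rho α * t ^ (2 / α))) t n)) atTop := by
    intro t ht
    have ht0 : 0 < t := ht
    have hc : 0 < lamB + lamU * (rho α * t ^ (2 / α)) := by positivity
    have h3 := ENNReal.Tendsto.const_mul ((ENNReal.continuous_ofReal.tendsto _).comp
      (tendsto_shellBound (lamB := lamB) (t := t) hc))
      (Or.inr (ENNReal.ofReal_ne_top (r := 1 / (1 + t))))
    refine Eq.trans ?_ h3.liminf_eq.symm
    rw [← ENNReal.ofReal_mul (by positivity), mul_comm]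
    congr 2
    have e1 : m ^ (2 / α) = lamB / (rho α * lamU) := by
      rw [hm, ← Real.rpow_mul (by positivity)]
      have : α / 2 * (2 / α) = 1 := by field_simp
      rw [this, Real.rpow_one]
    rw [Real.div_rpow ht0.le hm0.le, e1]
    field_simp
  rw [setLIntegral_congr_fun measurableSet_Ioi h2] at h1
  have hmeas : ∀ n, Measurable fun t : ℝ => ENNReal.ofReal (1 / (1 + t)) *
      ENNReal.ofReal (shellBound lamB (lamB + lamU * (rho α * t ^ (2 / α))) t n) := fun n => by
    unfold shellBound
    fun_prop
  -- By Fatou the strict inequality survives at a finite `n`, for which the tolerated noise is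
  -- positive.
  exact (eventually_lt_of_lt_liminf (h1.trans_le (lintegral_liminf_le hmeas))).exists

lemma seBound_lt_spectralEfficiency {Ω : Type*} [MeasurableSpace Ω] {P : Measure Ω}
    [IsProbabilityMeasure P] {X : ℕ → Ω → Plane} {α lamB lamU noise : ℝ} (hα : 2 < α)
    (hB : 0 < lamB) (hU : 0 < lamU) {n : ℕ} (hn : noise ≤ noiseLevel α n)
    (hlt : ENNReal.ofReal (seBound α lamB lamU) < ∫⁻ t in Set.Ioi (0 : ℝ),
      ENNReal.ofReal (1 / (1 + t)) *
        ENNReal.ofReal (shellBound lamB (lamB + lamU * (rho α * t ^ (2 / α))) t n))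
    (hX : ∀ n, Measurable (X n)) {Z : Ω → ℝ≥0∞} (hZ : Measurable Z)
    (h : ∀ t δ : ℝ, 0 < t → 0 < δ → ∀ k : ℕ, 1 ≤ k →
      ENNReal.ofReal (shellTerm α lamB lamU noise t δ k) ≤
        P {ω | (fun n => X n ω) ∈ shell δ k ∧ ENNReal.ofReal t < Z ω}) :
    ENNReal.ofReal (seBound α lamB lamU) < spectralEfficiency P Z := by
  refine hlt.trans_le (le_trans ?_ (lintegral_measure_le_spectralEfficiency hZ))
  refine setLIntegral_mono' measurableSet_Ioi fun t ht => ?_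
  gcongr
  refine (ENNReal.ofReal_le_ofReal (shellBound_le_sum hα hB hU ht hn)).trans ?_
  rw [ENNReal.ofReal_sum_of_nonneg fun k _ => by unfold shellTerm; positivity]
  exact sum_le_measure_of_shell hX (by positivity) _ (measurableSet_lt measurable_const hZ)
    fun k hk => h t _ ht (by positivity) k (Finset.mem_Icc.1 hk).1

/-- Subtracting the leading term leaves log(λ_B^(-α/2) + κ^(-α/2)), which converges and so is
negligible against log λ_B. -/
lemma isEquivalent_seBound {α lamU : ℝ} (hα : 2 < α) (hU : 0 < lamU) :
    (fun lamB : ℝ => seBound α lamB lamU) ~[atTop] fun lamB : ℝ => α / 2 * Real.log lamB := by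
  have hr := rho_pos hα
  set κ := rho α * lamU with hκ
  have hκ0 : 0 < κ := by positivity
  have ha : 0 < α / 2 := by linarith
  have h1 : (fun lamB : ℝ => seBound α lamB lamU - α / 2 * Real.log lamB) =ᶠ[atTop]
      fun lamB => Real.log (lamB ^ (-(α / 2)) + κ ^ (-(α / 2))) := by
    filter_upwards [eventually_gt_atTop 0] with x hx
    have hxp : 0 < x ^ (α / 2) := Real.rpow_pos_of_pos hx _
    have e1 : 1 + (x / κ) ^ (α / 2) = x ^ (α / 2) * (x ^ (-(α / 2)) + κ ^ (-(α / 2))) := by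
      rw [Real.div_rpow hx.le hκ0.le, Real.rpow_neg hx.le, Real.rpow_neg hκ0.le]
      field_simp
    unfold seBound
    rw [← hκ, e1, Real.log_mul hxp.ne' (by positivity), Real.log_rpow hx]
    ring
  have h2 : Tendsto (fun x : ℝ => Real.log (x ^ (-(α / 2)) + κ ^ (-(α / 2)))) atTop
      (𝓝 (Real.log (0 + κ ^ (-(α / 2))))) := by
    have h3 := (tendsto_rpow_neg_atTop ha).add_const (κ ^ (-(α / 2)))
    exact (Real.continuousAt_log (by positivity)).tendsto.comp h3
  have h4 : Tendsto (fun x : ℝ => α / 2 * Real.log x) atTop atTop :=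
    Real.tendsto_log_atTop.const_mul_atTop ha
  unfold IsEquivalent
  refine IsBigO.trans_isLittleO (g := fun _ : ℝ => (1 : ℝ))
    ((h2.congr' h1.symm).isBigO_one ℝ) ?_
  exact (isLittleO_const_left_of_ne one_ne_zero).2 (tendsto_norm_atTop_atTop.comp h4)

end UltraDense

end

theorem proposition1 (α : ℝ) (hα : 2 < α) :
    (∀ lamB lamU : ℝ, 0 < lamB → 0 < lamU → ∃ noise₀ : ℝ, 0 < noise₀ ∧
      ∀ (Ω : Type*) [MeasurableSpace Ω] (P : Measure Ω) [IsProbabilityMeasure P]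
        (X U : ℕ → Ω → UltraDense.Plane) (g : ℕ → Ω → ℝ) (h : Option ℕ → Ω → ℝ),
        UltraDense.IsHomogeneousPPP P X lamB →
        UltraDense.IsHomogeneousPPP P U lamU →
        IndepFun (fun ω n => X n ω) (fun ω n => U n ω) P →
        UltraDense.IsRayleighFading P g X U →
        UltraDense.IsRayleighFading P h X U →
        ∀ noise : ℝ, 0 ≤ noise → noise ≤ noise₀ →
          ENNReal.ofReal (UltraDense.seBound α lamB lamU) <
            UltraDense.spectralEfficiency P (fun ω =>
              UltraDense.downlinkSINR α noise (fun n => X n ω) (fun n => U n ω)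
                (fun i => g i ω)) ∧
          ∀ S : Ω → Set ℕ, UltraDense.IsUplinkSchedule P X U S →
            ENNReal.ofReal (UltraDense.seBound α lamB lamU) <
              UltraDense.spectralEfficiency P (fun ω =>
                UltraDense.uplinkSINR α noise (fun n => X n ω) (fun n => U n ω)
                  (fun j => h j ω) (S ω))) ∧
    (∀ lamU : ℝ, 0 < lamU →
      (fun lamB : ℝ => UltraDense.seBound α lamB lamU) ~[atTop]
        fun lamB : ℝ => α / 2 * Real.log lamB) := by
  refine ⟨fun lamB lamU hB hU => ?_, fun lamU hU => UltraDense.isEquivalent_seBound hα hU⟩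
  -- The mesh is chosen from `α`, `lamB` and `lamU` alone, before any probability space, so one
  -- noise threshold serves both links and all schedules.
  obtain ⟨n, hlt⟩ := UltraDense.exists_seBound_lt hα hB hU
  refine ⟨UltraDense.noiseLevel α n, UltraDense.noiseLevel_pos α n, ?_⟩
  intro Ω _ P _ X U g h hX hUP hXU hg hh noise hn0 hn
  refine ⟨?_, fun S hS => ?_⟩
  · exact UltraDense.seBound_lt_spectralEfficiency hα hB hU hn hlt hX.measurable
      (UltraDense.measurable_downlinkSINR hX.measurable hUP.measurable hg.measurable α noise)
      fun t δ ht hδ k hk => UltraDense.downlink_shell hX hUP hXU hg hα hB hU hn0 ht hδ hk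
  · exact UltraDense.seBound_lt_spectralEfficiency hα hB hU hn hlt hX.measurable
      (UltraDense.measurable_uplinkSINR hX.measurable hUP.measurable hh.measurable hS.measurable
        α noise)
      fun t δ ht hδ k hk => UltraDense.uplink_shell hX hUP hXU hh hα hB hU hn0 ht hδ hk S
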